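/- Let $\lambda,\mu>0$. For $n\ge 0$ let $c_n(\lambda)=\lambda(\lambda+1)\cdots(\lambda+n-1)/n!$ be the coefficient of $x^n$ in $(1-x)^{-\lambda}$. Let $\mathcal M^{(\lambda,\mu)}$ be the Hilbert space of holomorphic functions on the open bidisc $\mathbb D^2$ with orthonormal basis $c_m(\lambda)^{1/2}c_n(\mu)^{1/2}z_1^m z_2^n$ $(m,n\ge 0)$, i.e. the Hilbert space with reproducing kernel $(1-z_1\bar w_1)^{-\lambda}(1-z_2\bar w_2)^{-\mu}$. Let $\mathcal A(\mathbb D^2)$ be the bidisc algebra (continuous functions on $\overline{\mathbb D}^2$ that are holomorphic on $\mathbb D^2$, with the supremum norm), and let $\mathcal A_{\lambda,\mu}$ be the algebra of all $f\in\mathcal A(\mathbb D^2)$ with $f\cdot\mathcal M^{(\lambda,\mu)}\subseteq\mathcal M^{(\lambda,\mu)}$; it acts on $\mathcal M^{(\lambda,\mu)}$ by pointwise multiplication. Let $\mathcal M_0^{(\lambda,\mu)}$ be the $\mathcal A_{\lambda,\mu}$-submodule of those $h\in\mathcal M^{(\lambda,\mu)}$ that vanish to order $2$ on the diagonal $\{(z,z):z\in\mathbb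 D\}$, i.e. $h=(z_1-z_2)^2g$ with $g$ holomorphic on $\mathbb D^2$, and let $\mathcal Q^{(\lambda,\mu)}=\mathcal M^{(\lambda,\mu)}/\mathcal M_0^{(\lambda,\mu)}$, with the quotient norm and the module action $f\cdot(h+\mathcal M_0^{(\lambda,\mu)})=fh+\mathcal M_0^{(\lambda,\mu)}$. Then: 1. $\mathcal M_0^{(\lambda,\mu)}$ is closed, so that $\mathcal Q^{(\lambda,\mu)}$ is a Hilbert space. 2. $\mathcal A_{\lambda,\mu}$ contains all polynomials in $z_1,z_2$. If $\lambda,\mu\ge 1$, then $\mathcal A_{\lambda,\mu}=\mathcal A(\mathbb D^2)$, and there is a constant $C$ with $\|fh\|\le C\|f\|_\infty\|h\|$ for all $f\in\mathcal A(\mathbb D^2)$ and $h\in\mathcal M^{(\lambda,\mu)}$. 3. $\mathcal Q^{(\lambda,\mu)}$ is Möb-homogeneous: for every Möbius map $\varphi(z)=e^{i\theta}\frac{z-\alpha}{1-\bar\alpha z}$ ($\theta\in\mathbb R$, $|\alpha|<1$), writing $\phi=(\varphi,\varphi)$, one has $f\circ\phi\in\mathcal A_{\lambda,\mu}$ for all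 $f\in\mathcal A_{\lambda,\mu}$, and $\mathcal Q^{(\lambda,\mu)}$ is isomorphic to $\varphi_*\mathcal Q^{(\lambda,\mu)}$, the same Hilbert space with the action $(f,q)\mapsto (f\circ\phi)\cdot q$; that is, there is a unitary $U$ on $\mathcal Q^{(\lambda,\mu)}$ with $U(f\cdot q)=(f\circ\phi)\cdot U q$ for all $f\in\mathcal A_{\lambda,\mu}$ and $q\in\mathcal Q^{(\lambda,\mu)}$. -/

import Mathlib

open Metric

noncomputable section

namespace Bidisc

/-- Positive real numbers, the range of the parameters `λ` and `μ`. -/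
abbrev PosReal : Type := {x : ℝ // 0 < x}

/-- The open bidisc `𝔻²`. -/
abbrev openBidisc : Set (ℂ × ℂ) := ball (0 : ℂ) 1 ×ˢ ball (0 : ℂ) 1

/-- The closed bidisc, the closure of `𝔻²`. -/
abbrev closedBidisc : Set (ℂ × ℂ) := closedBall (0 : ℂ) 1 ×ˢ closedBall (0 : ℂ) 1

/-- The coefficient of `x ^ n` in `(1 - x) ^ (-λ)`, that is, `λ (λ + 1) ⋯ (λ + n - 1) / n!`. -/
def binomCoeff (lam : ℝ) (n : ℕ) : ℝ :=
  (∏ i ∈ Finset.range n, (lam + i)) / (n.factorial : ℝ)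

theorem binomCoeff_pos (lam : PosReal) (n : ℕ) : 0 < binomCoeff lam n := by
  have h : (0 : ℝ) < lam := lam.2
  unfold binomCoeff
  refine div_pos (Finset.prod_pos fun i _ => ?_) (by exact_mod_cast n.factorial_pos)
  positivity

theorem binomCoeff_succ (lam : ℝ) (n : ℕ) :
    binomCoeff lam (n + 1) = binomCoeff lam n * ((lam + n) / (n + 1)) := by
  unfold binomCoeff
  rw [Finset.prod_range_succ, Nat.factorial_succ]
  push_cast
  have h1 : (n.factorial : ℝ) ≠ 0 := by exact_mod_cast n.factorial_ne_zero
  have h2 : (n : ℝ) + 1 ≠ 0 := by positivity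
  field_simp

theorem summable_binomCoeff (lam : PosReal) {x : ℝ} (hx0 : 0 ≤ x) (hx : x < 1) :
    Summable fun n => binomCoeff lam n * x ^ n := by
  rcases hx0.eq_or_lt with rfl | hx0
  · refine summable_of_ne_finset_zero (s := {0}) fun n hn => ?_
    have : n ≠ 0 := by simpa using hn
    simp [this]
  have hpos : ∀ n, 0 < binomCoeff lam n * x ^ n := fun n =>
    mul_pos (binomCoeff_pos lam n) (pow_pos hx0 n)
  refine summable_of_ratio_test_tendsto_lt_one hx (.of_forall fun n => (hpos n).ne') ?_
  have key : ∀ n : ℕ, ‖binomCoeff lam (n + 1) * x ^ (n + 1)‖ / ‖binomCoeff lam n * x ^ n‖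
      = (1 + ((lam : ℝ) - 1) / ((n : ℝ) + 1)) * x := by
    intro n
    rw [Real.norm_of_nonneg (hpos _).le, Real.norm_of_nonneg (hpos _).le, binomCoeff_succ]
    have h1 := (binomCoeff_pos lam n).ne'
    have h2 : (n : ℝ) + 1 ≠ 0 := by positivity
    have h3 := hx0.ne'
    field_simp
    ring
  simp_rw [key]
  have h := tendsto_one_div_add_atTop_nhds_zero_nat (𝕜 := ℝ)
  have h' := ((h.const_mul ((lam : ℝ) - 1)).const_add 1).mul_const x
  simpa [div_eq_mul_inv] using h'

/-- The Hilbert space `M^(λ,μ)`: the space of square summable families of coefficients with respect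
to the orthonormal basis `e_m^(λ)(z₁) e_n^(μ)(z₂)`, where `e_n^(λ)(z) = c_n^(1/2) z ^ n` and `c_n` is
`binomCoeff λ n`.  It is realised as a space of functions on the bidisc below. -/
def HilbM (_lam _mu : PosReal) : Type :=
  lp (fun _ : ℕ × ℕ => ℂ) 2

instance (lam mu : PosReal) : NormedAddCommGroup (HilbM lam mu) :=
  inferInstanceAs (NormedAddCommGroup (lp (fun _ : ℕ × ℕ => ℂ) 2))

instance (lam mu : PosReal) : InnerProductSpace ℂ (HilbM lam mu) :=
  inferInstanceAs (InnerProductSpace ℂ (lp (fun _ : ℕ × ℕ => ℂ) 2))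

instance (lam mu : PosReal) : CompleteSpace (HilbM lam mu) :=
  inferInstanceAs (CompleteSpace (lp (fun _ : ℕ × ℕ => ℂ) 2))

/-- The coefficient of `h` along the basis vector with index `p = (m, n)`. -/
def HilbM.coeff {lam mu : PosReal} (h : HilbM lam mu) (p : ℕ × ℕ) : ℂ :=
  (show lp (fun _ : ℕ × ℕ => ℂ) 2 from h) p

/-- The basis function `c_m(λ)^(1/2) z₁ ^ m * c_n(μ)^(1/2) z₂ ^ n`, where `p = (m, n)`. -/
def basisFun (lam mu : PosReal) (p : ℕ × ℕ) (z : ℂ × ℂ) : ℂ :=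
  (√(binomCoeff lam p.1) * z.1 ^ p.1) * (√(binomCoeff mu p.2) * z.2 ^ p.2)

theorem memlp_basisFun (lam mu : PosReal) {z : ℂ × ℂ} (hz : z ∈ openBidisc) :
    Memℓp (fun p => star (basisFun lam mu p z)) 2 := by
  have h1 : ‖z.1‖ < 1 := by simpa using hz.1
  have h2 : ‖z.2‖ < 1 := by simpa using hz.2
  refine memℓp_gen ?_
  have hs := (summable_binomCoeff lam (x := ‖z.1‖ ^ 2) (by positivity)
    (by nlinarith [norm_nonneg z.1])).mul_of_nonneg
    (summable_binomCoeff mu (x := ‖z.2‖ ^ 2) (by positivity) (by nlinarith [norm_nonneg z.2]))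
    (fun n => mul_nonneg (binomCoeff_pos lam n).le (by positivity))
    (fun n => mul_nonneg (binomCoeff_pos mu n).le (by positivity))
  refine hs.congr fun p => ?_
  have e1 := Real.sq_sqrt (binomCoeff_pos lam p.1).le
  have e2 := Real.sq_sqrt (binomCoeff_pos mu p.2).le
  have : ‖star (basisFun lam mu p z)‖ = (√(binomCoeff lam p.1) * ‖z.1‖ ^ p.1) *
      (√(binomCoeff mu p.2) * ‖z.2‖ ^ p.2) := by
    simp [basisFun, abs_of_nonneg (Real.sqrt_nonneg _)]
  rw [this]
  simp only [ENNReal.toReal_ofNat, Real.rpow_ofNat]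
  rw [mul_pow, mul_pow, mul_pow, e1, e2]
  ring

/-- The value of `h` at a point of the bidisc is the inner product of `h` with this vector. -/
def kernelVec (lam mu : PosReal) (z : openBidisc) : HilbM lam mu :=
  (⟨_, memlp_basisFun lam mu z.2⟩ : lp (fun _ : ℕ × ℕ => ℂ) 2)

/-- Evaluation of the elements of `M^(λ,μ)` at the points of the bidisc. -/
def evalCLM (lam mu : PosReal) : HilbM lam mu →L[ℂ] (openBidisc → ℂ) :=
  ContinuousLinearMap.pi fun z => innerSL ℂ (kernelVec lam mu z)

/-- Evaluation is given by the expansion in the basis functions. -/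
theorem hasSum_evalCLM (lam mu : PosReal) (h : HilbM lam mu) (z : openBidisc) :
    HasSum (fun p => h.coeff p * basisFun lam mu p z) (evalCLM lam mu h z) := by
  have := lp.hasSum_inner (𝕜 := ℂ) (G := fun _ : ℕ × ℕ => ℂ)
    (kernelVec lam mu z : lp (fun _ : ℕ × ℕ => ℂ) 2) (h : lp (fun _ : ℕ × ℕ => ℂ) 2)
  refine (congrArg (HasSum · _) (funext fun p => ?_)).mp this
  simp [kernelVec, HilbM.coeff]

theorem eq_zero_of_powerSeries {d : ℕ → ℂ}
    (h : ∀ z : ℂ, ‖z‖ < 1 → HasSum (fun n => z ^ n * d n) 0) (n : ℕ) : d n = 0 := by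
  have h1 : HasFPowerSeriesAt (fun _ : ℂ => (0 : ℂ)) (FormalMultilinearSeries.ofScalars ℂ d) 0 := by
    rw [hasFPowerSeriesAt_iff]
    filter_upwards [ball_mem_nhds (0 : ℂ) one_pos] with z hz
    simpa using h z (by simpa using hz)
  have h2 := HasFPowerSeriesAt.eq_zero h1
  have h3 : (FormalMultilinearSeries.ofScalars ℂ d).coeff n = 0 := by rw [h2]; rfl
  simpa using h3

theorem evalCLM_injective (lam mu : PosReal) : Function.Injective (evalCLM lam mu) := by
  refine (injective_iff_map_eq_zero _).mpr fun h hh => ?_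
  set b : ℕ × ℕ → ℂ := fun p =>
    h.coeff p * ((√(binomCoeff lam p.1) : ℂ) * (√(binomCoeff mu p.2) : ℂ)) with hb
  have hsum : ∀ z w : ℂ, ‖z‖ < 1 → ‖w‖ < 1 →
      HasSum (fun p : ℕ × ℕ => z ^ p.1 * (w ^ p.2 * b p)) 0 := by
    intro z w hz hw
    have := hasSum_evalCLM lam mu h ⟨(z, w), by simpa using hz, by simpa using hw⟩
    rw [hh] at this
    refine (congrArg (HasSum · _) (funext fun p => ?_)).mp this
    simp only [hb, basisFun]
    ring
  have hb0 : ∀ p, b p = 0 := by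
    rintro ⟨m, n⟩
    refine eq_zero_of_powerSeries (d := fun n => b (m, n)) (fun w hw => ?_) n
    have hin : ∀ m, Summable fun n => w ^ n * b (m, n) := by
      intro m
      have h1 := ((hsum (1 / 2) w (by norm_num) hw).summable.prod_factor m).mul_left
        ((1 / 2 : ℂ) ^ m)⁻¹
      refine h1.congr fun n => ?_
      field_simp
    have h0 : ∀ m, ∑' n, w ^ n * b (m, n) = 0 := by
      refine eq_zero_of_powerSeries fun z hz => ?_
      exact (hsum z w hz hw).prod_fiberwise fun m => ((hin m).hasSum.mul_left (z ^ m))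
    have := (hin m).hasSum
    rwa [h0 m] at this
  have hc : ∀ p, h.coeff p = 0 := by
    intro p
    have h1 := (Real.sqrt_pos.mpr (binomCoeff_pos lam p.1)).ne'
    have h2 := (Real.sqrt_pos.mpr (binomCoeff_pos mu p.2)).ne'
    have := hb0 p
    simpa [hb, h1, h2] using this
  exact lp.ext (funext hc)

/-- `M^(λ,μ)` is a Hilbert space of functions on the bidisc. -/
instance (lam mu : PosReal) : RKHS ℂ (HilbM lam mu) openBidisc ℂ where
  coeCLM := evalCLM lam mu
  coeCLM_injective := evalCLM_injective lam mu

theorem HilbM.hasSum_apply {lam mu : PosReal} (h : HilbM lam mu) (z : openBidisc) :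
    HasSum (fun p => h.coeff p * basisFun lam mu p z) (h z) :=
  hasSum_evalCLM lam mu h z

theorem openBidisc_subset : openBidisc ⊆ closedBidisc :=
  Set.prod_mono ball_subset_closedBall ball_subset_closedBall

/-- A point of the open bidisc as a point of the closed bidisc. -/
def incl (z : openBidisc) : closedBidisc := ⟨z, openBidisc_subset z.2⟩

instance : CompactSpace closedBidisc :=
  isCompact_iff_compactSpace.mp ((isCompact_closedBall _ _).prod (isCompact_closedBall _ _))

/-- A function on the open bidisc is holomorphic. -/
def IsHolo (g : openBidisc → ℂ) : Prop :=
  ∃ G : ℂ × ℂ → ℂ, DifferentiableOn ℂ G openBidisc ∧ ∀ z : openBidisc, g z = G z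

theorem IsHolo.add {f g : openBidisc → ℂ} (hf : IsHolo f) (hg : IsHolo g) : IsHolo (f + g) := by
  obtain ⟨F, hF, hF'⟩ := hf
  obtain ⟨G, hG, hG'⟩ := hg
  exact ⟨F + G, hF.add hG, fun z => by simp [hF', hG']⟩

theorem IsHolo.mul {f g : openBidisc → ℂ} (hf : IsHolo f) (hg : IsHolo g) : IsHolo (f * g) := by
  obtain ⟨F, hF, hF'⟩ := hf
  obtain ⟨G, hG, hG'⟩ := hg
  exact ⟨F * G, hF.mul hG, fun z => by simp [hF', hG']⟩

theorem IsHolo.const (c : ℂ) : IsHolo fun _ => c :=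
  ⟨fun _ => c, differentiableOn_const c, fun _ => rfl⟩

/-- The bidisc algebra `A(𝔻²)`: the continuous functions on the closed bidisc that are holomorphic
on the open bidisc, with the supremum norm. -/
def bidiscAlgebra : Subalgebra ℂ C(closedBidisc, ℂ) where
  carrier := {f | IsHolo fun z => f (incl z)}
  mul_mem' hf hg := IsHolo.mul hf hg
  add_mem' hf hg := IsHolo.add hf hg
  algebraMap_mem' c := IsHolo.const c

/-- The algebra of those functions of the bidisc algebra which multiply `M^(λ,μ)` into itself. -/
def actingAlgebra (lam mu : PosReal) : Subalgebra ℂ C(closedBidisc, ℂ) where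
  carrier := {f | f ∈ bidiscAlgebra ∧
    ∀ h : HilbM lam mu, ∃ k : HilbM lam mu, ∀ z, k z = f (incl z) * h z}
  mul_mem' := by
    rintro f g ⟨hf, hf'⟩ ⟨hg, hg'⟩
    refine ⟨bidiscAlgebra.mul_mem hf hg, fun h => ?_⟩
    obtain ⟨k, hk⟩ := hg' h
    obtain ⟨l, hl⟩ := hf' k
    exact ⟨l, fun z => by rw [hl, hk, ContinuousMap.mul_apply, mul_assoc]⟩
  add_mem' := by
    rintro f g ⟨hf, hf'⟩ ⟨hg, hg'⟩
    refine ⟨bidiscAlgebra.add_mem hf hg, fun h => ?_⟩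
    obtain ⟨k, hk⟩ := hf' h
    obtain ⟨l, hl⟩ := hg' h
    exact ⟨k + l, fun z => by
      rw [RKHS.coe_add, Pi.add_apply, hk, hl, ContinuousMap.add_apply, add_mul]⟩
  algebraMap_mem' c :=
    ⟨bidiscAlgebra.algebraMap_mem c, fun h => ⟨c • h, fun z => by
      rw [RKHS.coe_smul, Pi.smul_apply, smul_eq_mul]
      simp [Algebra.algebraMap_eq_smul_one]⟩⟩

/-- The module action is pointwise multiplication of functions. -/
instance (lam mu : PosReal) : SMul (actingAlgebra lam mu) (HilbM lam mu) where
  smul f h := (f.2.2 h).choose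

theorem smul_apply {lam mu : PosReal} (f : actingAlgebra lam mu) (h : HilbM lam mu)
    (z : openBidisc) : (f • h) z = (f : C(closedBidisc, ℂ)) (incl z) * h z :=
  (f.2.2 h).choose_spec z

instance (lam mu : PosReal) : Module (actingAlgebra lam mu) (HilbM lam mu) where
  one_smul h := RKHS.ext fun z => by simp [smul_apply]
  mul_smul f g h := RKHS.ext fun z => by simp [smul_apply, mul_assoc]
  smul_zero f := RKHS.ext fun z => by simp [smul_apply]
  smul_add f g h := RKHS.ext fun z => by simp [smul_apply, mul_add]
  add_smul f g h := RKHS.ext fun z => by simp [smul_apply, add_mul]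
  zero_smul h := RKHS.ext fun z => by simp [smul_apply]

instance (lam mu : PosReal) : IsScalarTower ℂ (actingAlgebra lam mu) (HilbM lam mu) where
  smul_assoc c f h := RKHS.ext fun z => by simp [smul_apply, mul_assoc]

/-- The submodule of `M^(λ,μ)` of the functions that vanish to order `k` on the diagonal, i.e. that
are divisible by `(z₁ - z₂) ^ k`, where `z₁ - z₂` is a defining function of the diagonal. -/
def vanishing (k : ℕ) (lam mu : PosReal) :
    Submodule (actingAlgebra lam mu) (HilbM lam mu) where
  carrier := {h | ∃ g : openBidisc → ℂ, IsHolo g ∧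
    ∀ z : openBidisc, h z = ((z : ℂ × ℂ).1 - (z : ℂ × ℂ).2) ^ k * g z}
  add_mem' := by
    rintro h h' ⟨g, hg, e⟩ ⟨g', hg', e'⟩
    exact ⟨g + g', hg.add hg', fun z => by
      rw [RKHS.coe_add, Pi.add_apply, Pi.add_apply, e, e', mul_add]⟩
  zero_mem' := ⟨fun _ => 0, IsHolo.const 0, fun z => by simp⟩
  smul_mem' := by
    rintro f h ⟨g, hg, e⟩
    refine ⟨(fun z => (f : C(closedBidisc, ℂ)) (incl z)) * g, IsHolo.mul f.2.1 hg, fun z => ?_⟩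
    rw [smul_apply, e, Pi.mul_apply]
    ring

/-- The quotient module `Q^(λ,μ) = M^(λ,μ) / M₀^(λ,μ)`, with the quotient norm. -/
def QuotM (lam mu : PosReal) : Type := HilbM lam mu ⧸ vanishing 2 lam mu

instance (lam mu : PosReal) : SeminormedAddCommGroup (QuotM lam mu) :=
  Submodule.Quotient.seminormedAddCommGroup (vanishing 2 lam mu)

instance (lam mu : PosReal) : Module (actingAlgebra lam mu) (QuotM lam mu) :=
  Submodule.Quotient.module (vanishing 2 lam mu)

instance (lam mu : PosReal) : NormedSpace ℂ (QuotM lam mu) :=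
  Submodule.Quotient.normedSpace (vanishing 2 lam mu) ℂ

/-- The Möbius map `φ_{α,θ}(z) = e^{iθ} (z - α) / (1 - conj α * z)`. -/
def mob (α : ℂ) (θ : ℝ) (z : ℂ) : ℂ :=
  Complex.exp (θ * Complex.I) * ((z - α) / (1 - star α * z))

theorem mob_denom_ne {α z : ℂ} (hα : ‖α‖ < 1) (hz : ‖z‖ ≤ 1) : 1 - star α * z ≠ 0 := by
  intro h
  have h1 : ‖star α * z‖ = 1 := by rw [← sub_eq_zero.mp h, norm_one]
  rw [norm_mul, norm_star] at h1
  nlinarith [norm_nonneg α, norm_nonneg z]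

theorem norm_mob_le {α z : ℂ} (hα : ‖α‖ < 1) (θ : ℝ) (hz : ‖z‖ ≤ 1) : ‖mob α θ z‖ ≤ 1 := by
  rw [mob, norm_mul, Complex.norm_exp_ofReal_mul_I, one_mul, norm_div,
    div_le_one (norm_pos_iff.mpr (mob_denom_ne hα hz))]
  refine le_of_sq_le_sq ?_ (norm_nonneg _)
  have ha : Complex.normSq α < 1 := by
    rw [Complex.normSq_eq_norm_sq]; nlinarith [norm_nonneg α]
  have hz' : Complex.normSq z ≤ 1 := by
    rw [Complex.normSq_eq_norm_sq]; nlinarith [norm_nonneg z]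
  have key : Complex.normSq (1 - star α * z) - Complex.normSq (z - α) =
      (1 - Complex.normSq α) * (1 - Complex.normSq z) := by
    simp [Complex.normSq_apply]
    ring
  rw [← Complex.normSq_eq_norm_sq, ← Complex.normSq_eq_norm_sq]
  nlinarith [mul_nonneg (sub_nonneg.mpr ha.le) (sub_nonneg.mpr hz')]

/-- The map `(z₁, z₂) ↦ (φ z₁, φ z₂)` of the closed bidisc, where `φ = φ_{α,θ}`. -/
def mobDiag (α : ℂ) (hα : ‖α‖ < 1) (θ : ℝ) : C(closedBidisc, closedBidisc) where
  toFun z := ⟨(mob α θ (z : ℂ × ℂ).1, mob α θ (z : ℂ × ℂ).2),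
    by simpa using norm_mob_le hα θ (by simpa using z.2.1),
    by simpa using norm_mob_le hα θ (by simpa using z.2.2)⟩
  continuous_toFun := by
    refine Continuous.subtype_mk (Continuous.prodMk ?_ ?_) _
    · refine continuous_const.mul (Continuous.div (by fun_prop) (by fun_prop) fun z => ?_)
      exact mob_denom_ne hα (by simpa using z.2.1)
    · refine continuous_const.mul (Continuous.div (by fun_prop) (by fun_prop) fun z => ?_)
      exact mob_denom_ne hα (by simpa using z.2.2)

/-- `Q^(λ,μ)` is Möb-homogeneous: for every Möbius map `φ`, the algebra that acts is invariant under
`f ↦ f ∘ (φ, φ)`, and `Q^(λ,μ)` is isomorphic, by a unitary module map, to the module `φ_* Q^(λ,μ)`,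
which is the same Hilbert space on which `f` acts as `f ∘ (φ, φ)` acts on `Q^(λ,μ)`. -/
def IsMobHomogeneous (lam mu : PosReal) : Prop :=
  ∀ (α : ℂ) (hα : ‖α‖ < 1) (θ : ℝ),
    ∃ hA : ∀ f ∈ actingAlgebra lam mu, f.comp (mobDiag α hα θ) ∈ actingAlgebra lam mu,
    ∃ U : QuotM lam mu ≃ₗᵢ[ℂ] QuotM lam mu,
      ∀ (f : actingAlgebra lam mu) (q : QuotM lam mu),
        U (f • q) =
          (⟨(f : C(closedBidisc, ℂ)).comp (mobDiag α hα θ), hA f f.2⟩ : actingAlgebra lam mu) •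
            U q

end Bidisc

end

/-!
Write `K_z` for the kernel vector at `z`, and `K(z, w) = ⟪K_z, K_w⟫`, which is
`(1 - z₁ w̄₁)^(-λ) (1 - z₂ w̄₂)^(-μ)` (`inner_kernelVec_eq`). An operator
`h ↦ J · (h ∘ ψ)` has an adjoint that takes `K_z` to `conj (J z) K_{ψ z}`, so its boundedness can be
tested on linear combinations of the `K_z` (`exists_weightedComp`); if it preserves the kernel, `ψ`
is onto and `J` has no zeros, it is unitary (`exists_unitary_weightedComp`).

*Closedness.* A power series `∑ b_{mn} z₁^m z₂^n` that vanishes on the diagonal is divisible by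
`z₁ - z₂`, and the coefficients of the quotient are finite sums of the `b_{mn}`
(`CauchyBound.powerSum_eq`). Hence `h` vanishes to order two on the diagonal if and only if certain
finite sums of its Taylor coefficients vanish (`mem_vanishing_two_iff`). These are continuous
functionals, so the submodule is closed.

*Multipliers.* The coordinate functions act as bounded weighted shifts, whence all polynomials act.
If `λ, μ ≥ 1`, the kernel is the Szegő kernel `S` of the bidisc times a power series in `z₁ w̄₁` and
`z₂ w̄₂` with nonnegative coefficients (`hasSum_szego_mul_kernel`). So the inequality
`(‖f‖² - f(z) conj f(w)) K(z, w) ≥ 0`, which says that `f` acts with norm at most `‖f‖`, follows from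
the same inequality for `S`. The latter expresses that `f` acts contractively, up to `‖f‖`, on the
Hardy space; it is proved for functions holomorphic on the closed bidisc by Cauchy's formula on the
torus (`szegoForm_le_of_holoClosed`), and in general by dilation (`szegoForm_le`).

*Homogeneity.* For a Möbius map `φ`, the kernel satisfies
`J(z) conj J(w) K(φ z, φ w) = K(z, w)`, where `J(z)` is, up to a unimodular constant,
`φ'(z₁)^(λ/2) φ'(z₂)^(μ/2)` (`mobWeight_mul_kernel`). So `h ↦ J · (h ∘ (φ, φ))` is a unitary of
`M^(λ,μ)`, which intertwines multiplication by `f` with multiplication by `f ∘ (φ, φ)`. As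
`φ z - φ w` is `z - w` times a holomorphic function without zeros, the unitary preserves the order of
vanishing on the diagonal, and so does its inverse. It therefore descends to a unitary of the quotient.
-/

noncomputable section

namespace Bidisc

/-! ### Weighted composition operators and the reproducing kernel -/

theorem inner_kernelVec {lam mu : PosReal} (z : openBidisc) (h : HilbM lam mu) :
    inner ℂ (kernelVec lam mu z) h = h z := rfl

/-- The kernel is the product of the binomial series in `z₁ w̄₁` and `z₂ w̄₂`. -/
theorem inner_kernelVec_kernelVec {lam mu : PosReal} (z w : openBidisc) :
    HasSum (fun p : ℕ × ℕ => (binomCoeff lam p.1 * ((z : ℂ × ℂ).1 * star (w : ℂ × ℂ).1) ^ p.1) *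
        (binomCoeff mu p.2 * ((z : ℂ × ℂ).2 * star (w : ℂ × ℂ).2) ^ p.2) : ℕ × ℕ → ℂ)
      (inner ℂ (kernelVec lam mu z) (kernelVec lam mu w)) := by
  have := (kernelVec lam mu w).hasSum_apply z
  refine (congrArg (HasSum · _) (funext fun p => ?_)).mp this
  have h1 : ((√(binomCoeff lam p.1) : ℝ) : ℂ) * (√(binomCoeff lam p.1) : ℝ) = binomCoeff lam p.1 := by
    rw [← Complex.ofReal_mul, Real.mul_self_sqrt (binomCoeff_pos lam _).le]
  have h2 : ((√(binomCoeff mu p.2) : ℝ) : ℂ) * (√(binomCoeff mu p.2) : ℝ) = binomCoeff mu p.2 := by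
    rw [← Complex.ofReal_mul, Real.mul_self_sqrt (binomCoeff_pos mu _).le]
  have h3 : (kernelVec lam mu w).coeff p = star (basisFun lam mu p w) := rfl
  rw [h3, ← h1, ← h2]
  simp only [basisFun, star_mul', star_pow, mul_pow, Complex.star_def, Complex.conj_ofReal]
  ring

/-- A function orthogonal to all the kernel vectors vanishes at every point. -/
theorem denseRange_linearCombination_kernelVec (lam mu : PosReal) :
    DenseRange (Finsupp.linearCombination ℂ (kernelVec lam mu)) := by
  have : (Submodule.span ℂ (Set.range (kernelVec lam mu)))ᗮ = ⊥ := by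
    refine (Submodule.eq_bot_iff _).mpr fun h hh => RKHS.ext fun z => ?_
    rw [← inner_kernelVec, RKHS.coe_zero, Pi.zero_apply]
    exact (Submodule.mem_orthogonal _ _).mp hh _ (Submodule.subset_span ⟨z, rfl⟩)
  have h2 := Submodule.topologicalClosure_eq_top_iff.mpr this
  rw [← Finsupp.range_linearCombination] at h2
  have h3 := Submodule.dense_iff_topologicalClosure_eq_top.mpr h2
  rwa [LinearMap.coe_range] at h3

/-- Boundedness of a weighted composition operator is tested on the linear combinations of the
kernel functions, on which its adjoint acts by `K_z ↦ conj (J z) K_{ψ z}`. -/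
theorem exists_weightedComp {lam mu : PosReal} (J : openBidisc → ℂ) (ψ : openBidisc → openBidisc)
    {C : ℝ} (hC : 0 ≤ C)
    (hJ : ∀ x : openBidisc →₀ ℂ,
      ‖Finsupp.linearCombination ℂ (fun z => star (J z) • kernelVec lam mu (ψ z)) x‖ ≤
        C * ‖Finsupp.linearCombination ℂ (kernelVec lam mu) x‖) :
    ∃ T : HilbM lam mu →L[ℂ] HilbM lam mu,
      (∀ h z, T h z = J z * h (ψ z)) ∧ ∀ h, ‖T h‖ ≤ C * ‖h‖ := by
  set A := Finsupp.linearCombination ℂ (kernelVec lam mu)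
  set B := Finsupp.linearCombination ℂ (fun z => star (J z) • kernelVec lam mu (ψ z))
  have hd := denseRange_linearCombination_kernelVec lam mu
  set S := B.extendOfNorm A
  have hS : ∀ z, S (kernelVec lam mu z) = star (J z) • kernelVec lam mu (ψ z) := fun z => by
    have := LinearMap.extendOfNorm_eq (f := B) (e := A) hd ⟨C, hJ⟩ (Finsupp.single z 1)
    simpa [A, B, S] using this
  refine ⟨S.adjoint, fun h z => ?_, fun h => ?_⟩
  · rw [← inner_kernelVec, ContinuousLinearMap.adjoint_inner_right, hS, inner_smul_left,
      inner_kernelVec]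
    simp
  · refine (S.adjoint.le_opNorm h).trans (mul_le_mul_of_nonneg_right ?_ (norm_nonneg h))
    rw [LinearIsometryEquiv.norm_map]
    exact LinearMap.opNorm_extendOfNorm_le hd hC hJ

theorem norm_sq_linearCombination {X H : Type*} [NormedAddCommGroup H] [InnerProductSpace ℂ H]
    (u : X → H) (x : X →₀ ℂ) :
    ((‖Finsupp.linearCombination ℂ u x‖ ^ 2 : ℝ) : ℂ) =
      ∑ i ∈ x.support, ∑ j ∈ x.support, star (x i) * x j * inner ℂ (u i) (u j) := by
  rw [Complex.ofReal_pow]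
  have h := inner_self_eq_norm_sq_to_K (𝕜 := ℂ) (Finsupp.linearCombination ℂ u x)
  refine h.symm.trans ?_
  rw [Finsupp.linearCombination_apply, Finsupp.sum, sum_inner]
  refine Finset.sum_congr rfl fun i _ => ?_
  rw [inner_sum]
  refine Finset.sum_congr rfl fun j _ => ?_
  rw [inner_smul_left, inner_smul_right]
  simp [mul_assoc]

/-- A weighted composition operator that preserves the kernel, and whose symbol is surjective and
weight nonvanishing, is unitary: its adjoint is isometric, and it is injective. -/
theorem exists_unitary_weightedComp {lam mu : PosReal} (J : openBidisc → ℂ)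
    (ψ : openBidisc → openBidisc) (hJ0 : ∀ z, J z ≠ 0) (hψ : Function.Surjective ψ)
    (hK : ∀ z w, J z * star (J w) * inner ℂ (kernelVec lam mu (ψ z)) (kernelVec lam mu (ψ w)) =
      inner ℂ (kernelVec lam mu z) (kernelVec lam mu w)) :
    ∃ U : HilbM lam mu ≃ₗᵢ[ℂ] HilbM lam mu, ∀ h z, U h z = J z * h (ψ z) := by
  have hnorm : ∀ x : openBidisc →₀ ℂ,
      ‖Finsupp.linearCombination ℂ (fun z => star (J z) • kernelVec lam mu (ψ z)) x‖ =
        ‖Finsupp.linearCombination ℂ (kernelVec lam mu) x‖ := by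
    intro x
    rw [← sq_eq_sq₀ (norm_nonneg _) (norm_nonneg _), ← Complex.ofReal_inj,
      norm_sq_linearCombination, norm_sq_linearCombination]
    refine Finset.sum_congr rfl fun i _ => Finset.sum_congr rfl fun j _ => ?_
    rw [← hK i j, inner_smul_left, inner_smul_right]
    simp [mul_assoc]
  set A := Finsupp.linearCombination ℂ (kernelVec lam mu)
  set B := Finsupp.linearCombination ℂ (fun z => star (J z) • kernelVec lam mu (ψ z))
  have hd := denseRange_linearCombination_kernelVec lam mu
  have hex : ∃ C, ∀ x, ‖B x‖ ≤ C * ‖A x‖ := ⟨1, fun x => by rw [one_mul, hnorm]⟩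
  set S := B.extendOfNorm A
  have hSA : ∀ x, S (A x) = B x := fun x => LinearMap.extendOfNorm_eq hd hex x
  have hS : ∀ z, S (kernelVec lam mu z) = star (J z) • kernelVec lam mu (ψ z) := fun z => by
    simpa [A, B, S] using hSA (Finsupp.single z 1)
  have hiso : ∀ h, ‖S h‖ = ‖h‖ := fun h =>
    hd.induction (P := fun h => ‖S h‖ = ‖h‖)
      (by rintro _ ⟨x, rfl⟩; rw [hSA, hnorm]) (isClosed_eq (by fun_prop) (by fun_prop)) h
  have hT : ∀ h z, S.adjoint h z = J z * h (ψ z) := fun h z => by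
    rw [← inner_kernelVec, ContinuousLinearMap.adjoint_inner_right, hS, inner_smul_left,
      inner_kernelVec]
    simp
  -- `S` is isometric and its adjoint, the operator in question, is injective, so `S` is onto.
  have hTS : S.adjoint ∘L S = 1 := S.norm_map_iff_adjoint_comp_self.mp hiso
  have hinj : Function.Injective S.adjoint := by
    refine (injective_iff_map_eq_zero _).mpr fun h hh => RKHS.ext fun w => ?_
    obtain ⟨z, rfl⟩ := hψ w
    have := hT h z
    rw [hh] at this
    simpa [hJ0 z] using this.symm
  have hST : ∀ h, S (S.adjoint h) = h := fun h => hinj (DFunLike.congr_fun hTS (S.adjoint h))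
  let e := LinearIsometryEquiv.ofSurjective
    (⟨S.toLinearMap, hiso⟩ : HilbM lam mu →ₗᵢ[ℂ] HilbM lam mu) fun h => ⟨_, hST h⟩
  refine ⟨e.symm, fun h z => ?_⟩
  rw [← hT, (e.symm_apply_eq).mpr (hST h).symm]

/-! ### Möbius maps of the disc and the transformation of the kernel -/

theorem exp_mul_star_exp (θ : ℝ) :
    Complex.exp (θ * Complex.I) * star (Complex.exp (θ * Complex.I)) = 1 := by
  rw [Complex.star_def, Complex.mul_conj, Complex.normSq_eq_norm_sq, Complex.norm_exp_ofReal_mul_I]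
  simp

/-- The identity `1 - φ z conj (φ w) = (1 - |α|²) (1 - z w̄) / ((1 - ᾱ z) conj (1 - ᾱ w))`, cleared of
denominators. -/
theorem one_sub_mob_mul_star {α z w : ℂ} (hα : ‖α‖ < 1) (θ : ℝ) (hz : ‖z‖ ≤ 1) (hw : ‖w‖ ≤ 1) :
    (1 - mob α θ z * star (mob α θ w)) * ((1 - star α * z) * star (1 - star α * w)) =
      ((1 - ‖α‖ ^ 2 : ℝ) : ℂ) * (1 - z * star w) := by
  have h1 := mob_denom_ne hα hz
  have h2 : star (1 - star α * w) ≠ 0 := star_ne_zero.mpr (mob_denom_ne hα hw)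
  have he := exp_mul_star_exp θ
  have hn : ((1 - ‖α‖ ^ 2 : ℝ) : ℂ) = 1 - α * star α := by
    rw [Complex.star_def, Complex.mul_conj, Complex.normSq_eq_norm_sq]
    push_cast; rfl
  have e : mob α θ z * star (mob α θ w) =
      (z - α) * star (w - α) / ((1 - star α * z) * star (1 - star α * w)) := by
    simp only [mob, star_mul', star_div₀]
    rw [mul_mul_mul_comm, he, one_mul, div_mul_div_comm]
  rw [e, sub_mul, div_mul_cancel₀ _ (mul_ne_zero h1 h2), hn]
  simp only [star_sub, star_mul', star_star, star_one]
  ring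

theorem mob_sub_mob {α z w : ℂ} (hα : ‖α‖ < 1) (θ : ℝ) (hz : ‖z‖ ≤ 1) (hw : ‖w‖ ≤ 1) :
    mob α θ z - mob α θ w = (z - w) * (Complex.exp (θ * Complex.I) * (1 - α * star α) *
      ((1 - star α * z)⁻¹ * (1 - star α * w)⁻¹)) := by
  have h1 := mob_denom_ne hα hz
  have h2 := mob_denom_ne hα hw
  rw [mob, mob, ← mul_sub, div_sub_div _ _ h1 h2, div_eq_mul_inv, mul_inv]
  ring

theorem norm_mob_lt {α z : ℂ} (hα : ‖α‖ < 1) (θ : ℝ) (hz : ‖z‖ < 1) : ‖mob α θ z‖ < 1 := by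
  refine (norm_mob_le hα θ hz.le).lt_of_ne fun h => ?_
  have := one_sub_mob_mul_star hα θ hz.le hz.le
  simp only [Complex.star_def, Complex.mul_conj, Complex.normSq_eq_norm_sq, h] at this
  have h2 : ((1 - ‖α‖ ^ 2) * (1 - ‖z‖ ^ 2) : ℝ) = 0 := by
    rw [← Complex.ofReal_inj]
    push_cast at this ⊢
    rw [← this]; simp
  have h3 : 0 < 1 - ‖α‖ ^ 2 := by nlinarith [norm_nonneg α]
  have h4 : 0 < 1 - ‖z‖ ^ 2 := by nlinarith [norm_nonneg z]
  exact (mul_pos h3 h4).ne' h2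

/-- The map `(z₁, z₂) ↦ (φ z₁, φ z₂)` of the open bidisc, where `φ = φ_{α,θ}`. -/
def mobOpen (α : ℂ) (hα : ‖α‖ < 1) (θ : ℝ) (z : openBidisc) : openBidisc :=
  ⟨(mob α θ (z : ℂ × ℂ).1, mob α θ (z : ℂ × ℂ).2),
    by simpa using norm_mob_lt hα θ (by simpa using z.2.1),
    by simpa using norm_mob_lt hα θ (by simpa using z.2.2)⟩

theorem mobDiag_incl {α : ℂ} (hα : ‖α‖ < 1) (θ : ℝ) (z : openBidisc) :
    mobDiag α hα θ (incl z) = incl (mobOpen α hα θ z) := rfl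

theorem norm_mobInv_lt {α : ℂ} (hα : ‖α‖ < 1) (θ : ℝ) :
    ‖-(Complex.exp (θ * Complex.I) * α)‖ < 1 := by
  rwa [norm_neg, norm_mul, Complex.norm_exp_ofReal_mul_I, one_mul]

/-- The inverse of `φ_{α,θ}` is `φ_{β,-θ}` with `β = -e^{iθ} α`. -/
theorem mob_mob_inv {α z : ℂ} (hα : ‖α‖ < 1) (θ : ℝ) (hz : ‖z‖ ≤ 1) :
    mob α θ (mob (-(Complex.exp (θ * Complex.I) * α)) (-θ) z) = z := by
  have he : Complex.exp (((-θ : ℝ) : ℂ) * Complex.I) = star (Complex.exp (θ * Complex.I)) := by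
    rw [Complex.star_def, ← Complex.exp_conj]; simp
  have hee := exp_mul_star_exp θ
  have hβ := norm_mobInv_lt hα θ
  have h1 := mob_denom_ne hβ hz
  have h2 := mob_denom_ne hα (norm_mob_le hβ (-θ) hz)
  rw [mob, mul_div_assoc', div_eq_iff h2]
  have hu : mob (-(Complex.exp (θ * Complex.I) * α)) (-θ) z *
      (1 - star (-(Complex.exp (θ * Complex.I) * α)) * z) =
        star (Complex.exp (θ * Complex.I)) * z + α := by
    rw [mob, mul_assoc, div_mul_cancel₀ _ h1, he]
    linear_combination α * hee
  refine mul_right_cancel₀ h1 ?_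
  generalize mob (-(Complex.exp (θ * Complex.I) * α)) (-θ) z = u at hu ⊢
  generalize Complex.exp (θ * Complex.I) = e at hu hee ⊢
  simp only [star_neg, star_mul'] at hu ⊢
  linear_combination (e + z * star α) * hu + (z - z * α * star α) * hee

theorem mobOpen_mobOpen_inv {α : ℂ} (hα : ‖α‖ < 1) (θ : ℝ) (z : openBidisc) :
    mobOpen α hα θ (mobOpen _ (norm_mobInv_lt hα θ) (-θ) z) = z :=
  Subtype.ext (Prod.ext (mob_mob_inv hα θ (mem_ball_zero_iff.mp z.2.1).le)
    (mob_mob_inv hα θ (mem_ball_zero_iff.mp z.2.2).le))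

theorem IsHolo.comp_mobOpen {g : openBidisc → ℂ} (hg : IsHolo g) {α : ℂ} (hα : ‖α‖ < 1) (θ : ℝ) :
    IsHolo fun z => g (mobOpen α hα θ z) := by
  obtain ⟨G, hG, hG'⟩ := hg
  refine ⟨fun z => G (mob α θ z.1, mob α θ z.2), ?_, fun z => hG' _⟩
  have h1 : DifferentiableOn ℂ (mob α θ) (ball 0 1) := fun z hz => by
    have := mob_denom_ne hα (mem_ball_zero_iff.mp hz).le
    unfold mob
    exact DifferentiableAt.differentiableWithinAt (by fun_prop (disch := assumption))
  have h2 : Set.MapsTo (mob α θ) (ball 0 1) (ball 0 1) := fun z hz =>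
    mem_ball_zero_iff.mpr (norm_mob_lt hα θ (mem_ball_zero_iff.mp hz))
  exact hG.comp ((h1.comp differentiableOn_fst fun z hz => hz.1).prodMk
    (h1.comp differentiableOn_snd fun z hz => hz.2)) fun z hz => ⟨h2 hz.1, h2 hz.2⟩

theorem re_one_sub_pos {z : ℂ} (hz : ‖z‖ < 1) : 0 < (1 - z).re := by
  have := Complex.re_le_norm z
  simp; linarith

theorem norm_mul_star_lt {z w : ℂ} (hz : ‖z‖ < 1) (hw : ‖w‖ < 1) : ‖z * star w‖ < 1 := by
  rw [norm_mul, norm_star]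
  exact mul_lt_one_of_nonneg_of_lt_one_left (norm_nonneg _) hz hw.le

/-- The binomial series `∑ c_n(λ) x ^ n = (1 - x) ^ (-λ)`, the power being written with the principal
logarithm. -/
theorem hasSum_binomCoeff (lam : ℝ) {x : ℂ} (hx : ‖x‖ < 1) :
    HasSum (fun n => (binomCoeff lam n : ℂ) * x ^ n) (Complex.exp (-lam * Complex.log (1 - x))) := by
  have h := (Complex.one_div_one_sub_cpow_hasFPowerSeriesOnBall_zero lam).hasSum
    (y := x) (by simpa [enorm_eq_nnnorm, ← NNReal.coe_lt_coe] using hx)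
  have hne : (1 : ℂ) - x ≠ 0 := fun h => by have := re_one_sub_pos hx; simp [h] at this
  rw [zero_add, Complex.cpow_def_of_ne_zero hne, one_div, ← Complex.exp_neg] at h
  rw [neg_mul, mul_comm (lam : ℂ)]
  refine (congrArg (HasSum · _) (funext fun n => ?_)).mp h
  have hc : Ring.choose ((lam : ℂ) + n - 1) n = binomCoeff lam n := by
    have h1 : ((lam : ℂ) + n - 1) = ((lam + n - 1 : ℝ) : ℂ) := by push_cast; rfl
    rw [h1, ← Complex.ofReal_choose, ← Ring.multichoose_eq, Complex.ofReal_inj, binomCoeff,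
      eq_div_iff (by exact_mod_cast n.factorial_ne_zero), mul_comm, ← nsmul_eq_mul,
      Ring.factorial_nsmul_multichoose_eq_ascPochhammer, Polynomial.ascPochhammer_smeval_eq_eval]
    clear h h1
    induction n with
    | zero => simp
    | succ n ih => rw [ascPochhammer_succ_eval, Finset.prod_range_succ, ih]
  rw [← hc, FormalMultilinearSeries.ofScalars_apply_eq, smul_eq_mul]

/-- The closed form `(1 - z₁ w̄₁)^(-λ) (1 - z₂ w̄₂)^(-μ)` of the reproducing kernel. -/
theorem inner_kernelVec_eq {lam mu : PosReal} (z w : openBidisc) :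
    inner ℂ (kernelVec lam mu z) (kernelVec lam mu w) =
      Complex.exp (-(lam : ℝ) * Complex.log (1 - (z : ℂ × ℂ).1 * star (w : ℂ × ℂ).1)) *
      Complex.exp (-(mu : ℝ) * Complex.log (1 - (z : ℂ × ℂ).2 * star (w : ℂ × ℂ).2)) := by
  have h1 := norm_mul_star_lt (mem_ball_zero_iff.mp z.2.1) (mem_ball_zero_iff.mp w.2.1)
  have h2 := norm_mul_star_lt (mem_ball_zero_iff.mp z.2.2) (mem_ball_zero_iff.mp w.2.2)
  have h := inner_kernelVec_kernelVec (lam := lam) (mu := mu) z w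
  have h3 := hasSum_binomCoeff lam h1
  have h4 := hasSum_binomCoeff mu h2
  have h5 := h3.mul h4 h.summable
  rw [← h.tsum_eq, ← h5.tsum_eq]

/-- The weight `((1 - |α|²)^(1/2) / (1 - ᾱ z)) ^ s`, the power being defined by the principal
branch of the logarithm; up to a unimodular constant it is `φ'(z) ^ (s / 2)`. -/
def mobWeight (s : ℝ) (α z : ℂ) : ℂ :=
  Complex.exp (s * ((Real.log (1 - ‖α‖ ^ 2) : ℝ) / 2 - Complex.log (1 - star α * z)))

theorem mobWeight_ne_zero (s : ℝ) (α z : ℂ) : mobWeight s α z ≠ 0 := Complex.exp_ne_zero _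

theorem mobWeight_mul_neg (s : ℝ) (α z : ℂ) : mobWeight s α z * mobWeight (-s) α z = 1 := by
  rw [mobWeight, mobWeight, ← Complex.exp_add, ← Complex.exp_zero]
  congr 1
  push_cast
  ring

theorem norm_star_mul_lt {α z : ℂ} (hα : ‖α‖ < 1) (hz : ‖z‖ < 1) : ‖star α * z‖ < 1 := by
  rw [mul_comm]; exact norm_mul_star_lt hz hα

theorem differentiableOn_mobWeight (s : ℝ) {α : ℂ} (hα : ‖α‖ < 1) :
    DifferentiableOn ℂ (mobWeight s α) (ball 0 1) := fun z hz => by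
  have h : 1 - star α * z ∈ Complex.slitPlane :=
    .inl (re_one_sub_pos (norm_star_mul_lt hα (mem_ball_zero_iff.mp hz)))
  unfold mobWeight
  exact DifferentiableAt.differentiableWithinAt (by fun_prop (disch := assumption))

theorem abs_log_im_lt {z : ℂ} (hz : 0 < z.re) : |(Complex.log z).im| < Real.pi / 2 := by
  rw [Complex.log_im, Complex.abs_arg_lt_pi_div_two_iff]
  exact .inl hz

/-- The one variable kernel `(1 - z w̄)^(-s)` is transformed into itself by `φ` and the weight. The
logarithms of both sides agree up to a multiple of `2 π i`, which vanishes because all the numbers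
involved lie in the right half-plane. -/
theorem mobWeight_mul_kernel (s : ℝ) {α z w : ℂ} (hα : ‖α‖ < 1) (θ : ℝ) (hz : ‖z‖ < 1)
    (hw : ‖w‖ < 1) :
    mobWeight s α z * star (mobWeight s α w) *
        Complex.exp (-s * Complex.log (1 - mob α θ z * star (mob α θ w))) =
      Complex.exp (-s * Complex.log (1 - z * star w)) := by
  have hA := re_one_sub_pos (norm_mul_star_lt hz hw)
  have hB := re_one_sub_pos (norm_star_mul_lt hα hz)
  have hC := re_one_sub_pos (norm_star_mul_lt hα hw)
  have hD := re_one_sub_pos (norm_mul_star_lt (norm_mob_lt hα θ hz) (norm_mob_lt hα θ hw))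
  have key := one_sub_mob_mul_star hα θ hz.le hw.le
  have ha : 0 < 1 - ‖α‖ ^ 2 := by nlinarith [norm_nonneg α]
  set A := 1 - z * star w
  set B := 1 - star α * z with hBdef
  set C := 1 - star α * w with hCdef
  set D := 1 - mob α θ z * star (mob α θ w)
  set a := 1 - ‖α‖ ^ 2
  have ne : ∀ {x : ℂ}, 0 < x.re → x ≠ 0 := fun h h' => by simp [h'] at h
  have hlog : Complex.log D + (Complex.log B + star (Complex.log C)) =
      (Real.log a : ℝ) + Complex.log A := by
    have hexp : Complex.exp (Complex.log D + (Complex.log B + star (Complex.log C))) =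
        Complex.exp ((Real.log a : ℝ) + Complex.log A) := by
      rw [Complex.exp_add, Complex.exp_add, Complex.exp_add, Complex.exp_log (ne hD),
        Complex.exp_log (ne hB), Complex.exp_log (ne hA), Complex.star_def, Complex.exp_conj,
        Complex.exp_log (ne hC), ← Complex.ofReal_exp, Real.exp_log ha]
      exact key
    obtain ⟨n, hn⟩ := Complex.exp_eq_exp_iff_exists_int.mp hexp
    -- Each argument lies in `(-π/2, π/2)`, so the two imaginary parts differ by less than `2 π`.
    have him := congrArg Complex.im hn
    simp only [Complex.add_im, Complex.ofReal_im, Complex.star_def, Complex.conj_im] at him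
    have him2 : (n * (2 * Real.pi * Complex.I) : ℂ).im = n * (2 * Real.pi) := by simp
    rw [him2] at him
    have h1 := abs_lt.mp (abs_log_im_lt hA)
    have h2 := abs_lt.mp (abs_log_im_lt hB)
    have h3 := abs_lt.mp (abs_log_im_lt hC)
    have h4 := abs_lt.mp (abs_log_im_lt hD)
    have hn1 : (n : ℝ) < 1 := by
      by_contra! h
      nlinarith [Real.pi_pos]
    have hn2 : (-1 : ℝ) < n := by
      by_contra! h
      nlinarith [Real.pi_pos]
    have hn0 : n = 0 := by
      have h5 : n < 1 := by exact_mod_cast hn1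
      have h6 : -1 < n := by exact_mod_cast hn2
      omega
    rw [hn, hn0]
    simp
  have hstar : star (mobWeight s α w) =
      Complex.exp (s * ((Real.log a : ℝ) / 2 - star (Complex.log C))) := by
    rw [mobWeight, Complex.star_def, ← Complex.exp_conj]
    simp [hCdef, a, map_ofNat]
  rw [hstar, mobWeight, ← Complex.exp_add, ← Complex.exp_add]
  congr 1
  linear_combination (-s : ℂ) * hlog

/-! ### Möbius homogeneity -/

/-- A weighted composition with a Möbius map and a holomorphic weight preserves the order of
vanishing on the diagonal, since `φ z - φ w` is `z - w` times a holomorphic function. -/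
theorem mem_vanishing_of_weightedComp {k : ℕ} {lam mu : PosReal} {h : HilbM lam mu}
    (hh : h ∈ vanishing k lam mu) {α : ℂ} (hα : ‖α‖ < 1) (θ : ℝ) {A : openBidisc → ℂ}
    (hA : IsHolo A) (h' : HilbM lam mu) (he : ∀ z, h' z = A z * h (mobOpen α hα θ z)) :
    h' ∈ vanishing k lam mu := by
  obtain ⟨g, hg, e⟩ := hh
  set q : ℂ × ℂ → ℂ := fun z => Complex.exp (θ * Complex.I) * (1 - α * star α) *
      ((1 - star α * z.1)⁻¹ * (1 - star α * z.2)⁻¹) with hq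
  have hq' : IsHolo fun z : openBidisc => q z ^ k := by
    refine ⟨fun z => q z ^ k, fun z hz => ?_, fun z => rfl⟩
    have h1 := mob_denom_ne hα (mem_ball_zero_iff.mp hz.1).le
    have h2 := mob_denom_ne hα (mem_ball_zero_iff.mp hz.2).le
    exact DifferentiableAt.differentiableWithinAt (by fun_prop (disch := assumption))
  refine ⟨A * ((fun z : openBidisc => q z ^ k) * fun z => g (mobOpen α hα θ z)),
    hA.mul (hq'.mul (hg.comp_mobOpen hα θ)), fun z => ?_⟩
  rw [he, e]
  have := mob_sub_mob hα θ (mem_ball_zero_iff.mp z.2.1).le (mem_ball_zero_iff.mp z.2.2).le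
  simp only [mobOpen, this, Pi.mul_apply, hq]
  rw [mul_pow]
  ring

theorem isHolo_mobWeight (s t : ℝ) {α : ℂ} (hα : ‖α‖ < 1) :
    IsHolo fun z => mobWeight s α (z : ℂ × ℂ).1 * mobWeight t α (z : ℂ × ℂ).2 :=
  ⟨fun z => mobWeight s α z.1 * mobWeight t α z.2,
    ((differentiableOn_mobWeight s hα).comp differentiableOn_fst fun _ hz => hz.1).mul
      ((differentiableOn_mobWeight t hα).comp differentiableOn_snd fun _ hz => hz.2),
    fun _ => rfl⟩

/-- The unitary of `M^(λ,μ)` given by the projective action of the Möbius group. -/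
theorem exists_mobUnitary (lam mu : PosReal) {α : ℂ} (hα : ‖α‖ < 1) (θ : ℝ) :
    ∃ U : HilbM lam mu ≃ₗᵢ[ℂ] HilbM lam mu, ∀ h z, U h z =
      (mobWeight lam α (z : ℂ × ℂ).1 * mobWeight mu α (z : ℂ × ℂ).2) * h (mobOpen α hα θ z) := by
  refine exists_unitary_weightedComp _ _
    (fun z => mul_ne_zero (mobWeight_ne_zero _ _ _) (mobWeight_ne_zero _ _ _))
    (fun z => ⟨_, mobOpen_mobOpen_inv hα θ z⟩) fun z w => ?_
  rw [inner_kernelVec_eq, inner_kernelVec_eq,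
    ← mobWeight_mul_kernel lam hα θ (mem_ball_zero_iff.mp z.2.1) (mem_ball_zero_iff.mp w.2.1),
    ← mobWeight_mul_kernel mu hα θ (mem_ball_zero_iff.mp z.2.2) (mem_ball_zero_iff.mp w.2.2)]
  simp only [mobOpen, star_mul']
  ring

theorem norm_quotient_mk_le {lam mu : PosReal} (T : HilbM lam mu →ₗᵢ[ℂ] HilbM lam mu)
    (hT : ∀ h ∈ vanishing 2 lam mu, T h ∈ vanishing 2 lam mu) (h : HilbM lam mu) :
    ‖(Submodule.Quotient.mk (T h) : HilbM lam mu ⧸ vanishing 2 lam mu)‖ ≤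
      ‖(Submodule.Quotient.mk h : HilbM lam mu ⧸ vanishing 2 lam mu)‖ := by
  refine le_of_forall_pos_lt_add fun ε hε => ?_
  obtain ⟨m, hm, hlt⟩ := Submodule.Quotient.norm_mk_lt (S := vanishing 2 lam mu)
    (Submodule.Quotient.mk h) hε
  have : (Submodule.Quotient.mk (T h) : HilbM lam mu ⧸ vanishing 2 lam mu) =
      Submodule.Quotient.mk (T m) := by
    rw [Submodule.Quotient.eq, ← map_sub]
    exact hT _ ((Submodule.Quotient.eq _).mp hm.symm)
  rw [this]
  exact ((Submodule.Quotient.norm_mk_le _ _).trans (T.norm_map m).le).trans_lt hlt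

/-- A unitary that preserves the submodule, together with its inverse, descends to the quotient. -/
theorem exists_quotient_isometry {lam mu : PosReal} (T : HilbM lam mu ≃ₗᵢ[ℂ] HilbM lam mu)
    (hT : ∀ h ∈ vanishing 2 lam mu, T h ∈ vanishing 2 lam mu)
    (hT' : ∀ h ∈ vanishing 2 lam mu, T.symm h ∈ vanishing 2 lam mu) :
    ∃ U : QuotM lam mu ≃ₗᵢ[ℂ] QuotM lam mu, ∀ h : HilbM lam mu,
      U (Submodule.Quotient.mk h : HilbM lam mu ⧸ vanishing 2 lam mu) =
        (Submodule.Quotient.mk (T h) : HilbM lam mu ⧸ vanishing 2 lam mu) := by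
  set V := vanishing 2 lam mu
  have hmap : (V.restrictScalars ℂ).map (T.toLinearEquiv : HilbM lam mu →ₗ[ℂ] HilbM lam mu) =
      V.restrictScalars ℂ := by
    ext h
    constructor
    · rintro ⟨k, hk, rfl⟩
      exact hT k hk
    · exact fun hh => ⟨T.symm h, hT' h hh, T.apply_symm_apply h⟩
  let r := Submodule.Quotient.restrictScalarsEquiv ℂ V
  let e : (HilbM lam mu ⧸ V) ≃ₗ[ℂ] (HilbM lam mu ⧸ V) :=
    r.symm ≪≫ₗ Submodule.Quotient.equiv _ _ T.toLinearEquiv hmap ≪≫ₗ r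
  have he : ∀ h, e (Submodule.Quotient.mk h) = Submodule.Quotient.mk (T h) := fun h => rfl
  refine ⟨(⟨e, fun q => ?_⟩ : QuotM lam mu ≃ₗᵢ[ℂ] QuotM lam mu), he⟩
  obtain ⟨h, rfl⟩ := Submodule.Quotient.mk_surjective _ q
  refine le_antisymm (norm_quotient_mk_le T.toLinearIsometry hT h) ?_
  have := norm_quotient_mk_le T.symm.toLinearIsometry hT' (T h)
  rw [LinearIsometryEquiv.coe_toLinearIsometry, T.symm_apply_apply] at this
  exact this

theorem isMobHomogeneous (lam mu : PosReal) : IsMobHomogeneous lam mu := by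
  intro α hα θ
  obtain ⟨T, hT⟩ := exists_mobUnitary lam mu hα θ
  have hA : ∀ f ∈ actingAlgebra lam mu, f.comp (mobDiag α hα θ) ∈ actingAlgebra lam mu := by
    rintro f ⟨hf, hf'⟩
    refine ⟨hf.comp_mobOpen hα θ, fun h => ?_⟩
    -- Multiplication by `f ∘ (φ, φ)` is the conjugate by `T` of multiplication by `f`.
    obtain ⟨k, hk⟩ := hf' (T.symm h)
    refine ⟨T k, fun z => ?_⟩
    rw [hT, hk, ContinuousMap.comp_apply, mobDiag_incl, mul_left_comm, ← hT, T.apply_symm_apply]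
  have hTV : ∀ h ∈ vanishing 2 lam mu, T h ∈ vanishing 2 lam mu := fun h hh =>
    mem_vanishing_of_weightedComp hh hα θ (isHolo_mobWeight _ _ hα) _ (hT h)
  have hTV' : ∀ h ∈ vanishing 2 lam mu, T.symm h ∈ vanishing 2 lam mu := fun h hh => by
    refine mem_vanishing_of_weightedComp hh (norm_mobInv_lt hα θ) (-θ)
      ((isHolo_mobWeight (-lam) (-mu) hα).comp_mobOpen (norm_mobInv_lt hα θ) (-θ)) _ fun z => ?_
    -- Solve `h = J * (T.symm h ∘ φ)` for `T.symm h` at the point `w = φ z`, `z = φ⁻¹ w`.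
    have h1 := hT (T.symm h) (mobOpen _ (norm_mobInv_lt hα θ) (-θ) z)
    rw [T.apply_symm_apply, mobOpen_mobOpen_inv] at h1
    rw [h1, ← mul_assoc, mul_mul_mul_comm, mul_comm (mobWeight (-lam) _ _), mobWeight_mul_neg,
      mul_comm (mobWeight (-mu) _ _), mobWeight_mul_neg, one_mul, one_mul]
  obtain ⟨U, hU⟩ := exists_quotient_isometry T hTV hTV'
  refine ⟨hA, U, fun f q => ?_⟩
  obtain ⟨h, rfl⟩ := Submodule.Quotient.mk_surjective (vanishing 2 lam mu) q
  refine (hU (f • h)).trans ?_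
  rw [hU h]
  refine congrArg (Submodule.Quotient.mk (p := vanishing 2 lam mu)) (RKHS.ext fun z => ?_)
  rw [smul_apply, hT, smul_apply, hT, ContinuousMap.comp_apply, mobDiag_incl, mul_left_comm]

/-! ### Division by `z₁ - z₂` and closedness -/

/-- The Cauchy estimates for the coefficients of a power series convergent on the bidisc. -/
def CauchyBound (b : ℕ × ℕ → ℂ) : Prop :=
  ∀ r : ℝ, 0 < r → r < 1 → ∃ C, ∀ p : ℕ × ℕ, ‖b p‖ * r ^ (p.1 + p.2) ≤ C

/-- The sum of the power series in two variables with coefficients `b`. -/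
def powerSum (b : ℕ × ℕ → ℂ) (z : ℂ × ℂ) : ℂ := ∑' p : ℕ × ℕ, b p * (z.1 ^ p.1 * z.2 ^ p.2)

/-- On a polydisc of radius `s < 1` the terms of the series are dominated by a geometric series. -/
theorem CauchyBound.exists_norm_le {b : ℕ × ℕ → ℂ} (hb : CauchyBound b) {s : ℝ} (hs0 : 0 < s)
    (hs : s < 1) : ∃ C x : ℝ, 0 < x ∧ x < 1 ∧ 0 ≤ C ∧
      ∀ p : ℕ × ℕ, ‖b p‖ * (s ^ p.1 * s ^ p.2) ≤ C * (x ^ p.1 * x ^ p.2) := by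
  obtain ⟨r, hsr, hr⟩ := exists_between hs
  have hr0 := hs0.trans hsr
  obtain ⟨C, hC⟩ := hb r hr0 hr
  refine ⟨C, s / r, by positivity, (div_lt_one hr0).mpr hsr, ?_, fun p => ?_⟩
  · exact (by positivity : (0 : ℝ) ≤ _).trans (hC 0)
  · have := mul_le_mul_of_nonneg_right (hC p) (by positivity : 0 ≤ (s / r) ^ (p.1 + p.2))
    rw [← pow_add, ← pow_add]
    refine le_trans (le_of_eq ?_) this
    rw [mul_assoc, ← mul_pow, mul_div_cancel₀ _ hr0.ne']

theorem summable_geometric_prod {x : ℝ} (hx0 : 0 < x) (hx : x < 1) :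
    Summable fun p : ℕ × ℕ => x ^ p.1 * x ^ p.2 :=
  (summable_geometric_of_lt_one hx0.le hx).mul_of_nonneg (summable_geometric_of_lt_one hx0.le hx)
    (fun n => by positivity) fun n => by positivity

theorem exists_radius {z : ℂ × ℂ} (hz : z ∈ openBidisc) :
    ∃ s : ℝ, 0 < s ∧ s < 1 ∧ z ∈ ball (0 : ℂ) s ×ˢ ball (0 : ℂ) s := by
  have h1 : ‖z.1‖ < 1 := mem_ball_zero_iff.mp hz.1
  have h2 : ‖z.2‖ < 1 := mem_ball_zero_iff.mp hz.2
  obtain ⟨s, hs, hs1⟩ := exists_between (max_lt h1 h2)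
  have h3 := max_lt_iff.mp hs
  exact ⟨s, (norm_nonneg _).trans_lt h3.1, hs1, mem_ball_zero_iff.mpr h3.1,
    mem_ball_zero_iff.mpr h3.2⟩

theorem CauchyBound.summable {b : ℕ × ℕ → ℂ} (hb : CauchyBound b) {z : ℂ × ℂ}
    (hz : z ∈ openBidisc) : Summable fun p : ℕ × ℕ => b p * (z.1 ^ p.1 * z.2 ^ p.2) := by
  obtain ⟨s, hs0, hs, hz1, hz2⟩ := exists_radius hz
  obtain ⟨C, x, hx0, hx, -, h⟩ := hb.exists_norm_le hs0 hs
  refine ((summable_geometric_prod hx0 hx).mul_left C).of_norm_bounded fun p => ?_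
  refine le_trans ?_ (h p)
  rw [norm_mul, norm_mul, norm_pow, norm_pow]
  have h1 := (mem_ball_zero_iff.mp hz1).le
  have h2 := (mem_ball_zero_iff.mp hz2).le
  gcongr

theorem CauchyBound.of_summable {b : ℕ × ℕ → ℂ}
    (h : ∀ z ∈ openBidisc, Summable fun p : ℕ × ℕ => b p * (z.1 ^ p.1 * z.2 ^ p.2)) :
    CauchyBound b := fun r hr0 hr => by
  have hr' : ‖(r : ℂ)‖ < 1 := by simpa [abs_of_pos hr0] using hr
  have hs := (h (r, r) ⟨mem_ball_zero_iff.mpr hr', mem_ball_zero_iff.mpr hr'⟩).norm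
  refine ⟨_, fun p => le_trans (le_of_eq ?_) (hs.le_tsum p fun _ _ => norm_nonneg _)⟩
  simp [abs_of_pos hr0, pow_add]

/-- The sum is holomorphic, by termwise differentiation on smaller polydiscs. -/
theorem CauchyBound.differentiableOn {b : ℕ × ℕ → ℂ} (hb : CauchyBound b) :
    DifferentiableOn ℂ (powerSum b) openBidisc := by
  intro z hz
  obtain ⟨s, hs0, hs, hzs⟩ := exists_radius hz
  obtain ⟨C, x, hx0, hx, hC, h⟩ := hb.exists_norm_le hs0 hs
  have hg := summable_geometric_of_lt_one hx0.le hx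
  have hg' : Summable fun n : ℕ => (n : ℝ) * x ^ n := by
    simpa using summable_pow_mul_geometric_of_norm_lt_one (R := ℝ) 1
      (by rwa [Real.norm_of_nonneg hx0.le])
  have hu : Summable fun p : ℕ × ℕ =>
      s⁻¹ * C * ((p.1 * x ^ p.1) * x ^ p.2 + x ^ p.1 * (p.2 * x ^ p.2)) :=
    ((hg'.mul_of_nonneg hg (fun n => by positivity) fun n => by positivity).add
      (hg.mul_of_nonneg hg' (fun n => by positivity) fun n => by positivity)).mul_left _
  have hder : ∀ (p : ℕ × ℕ) (w : ℂ × ℂ), HasFDerivAt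
      (fun w : ℂ × ℂ => b p * (w.1 ^ p.1 * w.2 ^ p.2))
      (b p • (w.1 ^ p.1 • ((p.2 * w.2 ^ (p.2 - 1)) • ContinuousLinearMap.snd ℂ ℂ ℂ) +
        w.2 ^ p.2 • ((p.1 * w.1 ^ (p.1 - 1)) • ContinuousLinearMap.fst ℂ ℂ ℂ))) w := fun p w => by
    have h1 := (hasDerivAt_pow p.1 w.1).comp_hasFDerivAt w (hasFDerivAt_fst (𝕜 := ℂ) (p := w))
    have h2 := (hasDerivAt_pow p.2 w.2).comp_hasFDerivAt w (hasFDerivAt_snd (𝕜 := ℂ) (p := w))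
    exact (h1.mul h2).const_mul (b p)
  have hpow : ∀ (n : ℕ) {t : ℝ}, 0 ≤ t → t ≤ s → n * t ^ (n - 1) ≤ s⁻¹ * (n * s ^ n) := by
    intro n t ht hts
    rcases n with _ | n
    · simp
    · have h1 : s⁻¹ * ((n + 1 : ℕ) * s ^ (n + 1)) = (n + 1 : ℕ) * s ^ n := by
        rw [pow_succ]
        field_simp
      rw [h1, Nat.add_sub_cancel]
      gcongr
  refine (hasFDerivAt_tsum_of_isPreconnected hu (isOpen_ball.prod isOpen_ball)
    ((convex_ball (0 : ℂ) s).prod (convex_ball (0 : ℂ) s)).isPreconnected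
    (fun p w _ => hder p w) (fun p w hw => ?_) hzs (hb.summable hz)
    hzs).differentiableAt.differentiableWithinAt
  have h1 := (mem_ball_zero_iff.mp hw.1).le
  have h2 := (mem_ball_zero_iff.mp hw.2).le
  calc _ ≤ ‖b p‖ * (‖w.1‖ ^ p.1 * (p.2 * ‖w.2‖ ^ (p.2 - 1)) +
        ‖w.2‖ ^ p.2 * (p.1 * ‖w.1‖ ^ (p.1 - 1))) := by
        rw [norm_smul]
        gcongr
        refine (norm_add_le _ _).trans (add_le_add ?_ ?_)
        · rw [norm_smul, norm_smul, norm_pow, norm_mul, norm_pow, Complex.norm_natCast]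
          exact mul_le_mul_of_nonneg_left (mul_le_of_le_one_right (by positivity)
            (ContinuousLinearMap.norm_snd_le _ _ _)) (by positivity)
        · rw [norm_smul, norm_smul, norm_pow, norm_mul, norm_pow, Complex.norm_natCast]
          exact mul_le_mul_of_nonneg_left (mul_le_of_le_one_right (by positivity)
            (ContinuousLinearMap.norm_fst_le _ _ _)) (by positivity)
    _ ≤ ‖b p‖ * (s ^ p.1 * (s⁻¹ * (p.2 * s ^ p.2)) + s ^ p.2 * (s⁻¹ * (p.1 * s ^ p.1))) := by
        refine mul_le_mul_of_nonneg_left (add_le_add ?_ ?_) (norm_nonneg _)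
        · exact mul_le_mul (by gcongr) (hpow p.2 (norm_nonneg _) h2) (by positivity) (by positivity)
        · exact mul_le_mul (by gcongr) (hpow p.1 (norm_nonneg _) h1) (by positivity) (by positivity)
    _ = s⁻¹ * (p.1 + p.2) * (‖b p‖ * (s ^ p.1 * s ^ p.2)) := by ring
    _ ≤ s⁻¹ * (p.1 + p.2) * (C * (x ^ p.1 * x ^ p.2)) :=
        mul_le_mul_of_nonneg_left (h p) (by positivity)
    _ = _ := by ring

/-- The coefficient of `t ^ l` in the restriction of a power series to the diagonal. -/
def diagCoeff (b : ℕ × ℕ → ℂ) (l : ℕ) : ℂ := ∑ p ∈ Finset.HasAntidiagonal.antidiagonal l, b p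

/-- The coefficients of the quotient of `b` by `z₁ - z₂`, where `z₁ ^ m z₂ ^ n` is divided as
`(z₁ ^ m - z₂ ^ m) z₂ ^ n / (z₁ - z₂)`, with remainder the monomial `z₂ ^ (m + n)`. -/
def divDiag (b : ℕ × ℕ → ℂ) (p : ℕ × ℕ) : ℂ :=
  ∑ q ∈ Finset.HasAntidiagonal.antidiagonal p.2, b (p.1 + 1 + q.1, q.2)

theorem CauchyBound.hasSum_diag {b : ℕ × ℕ → ℂ} (hb : CauchyBound b) {t : ℂ} (ht : ‖t‖ < 1) :
    HasSum (fun l => t ^ l * diagCoeff b l) (powerSum b (t, t)) := by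
  have h := (hb.summable (z := (t, t))
    ⟨mem_ball_zero_iff.mpr ht, mem_ball_zero_iff.mpr ht⟩).hasSum
  have h2 := (Finset.HasAntidiagonal.sigmaAntidiagonalEquivProd.hasSum_iff.mpr h)
  refine h2.sigma fun l => ?_
  rw [diagCoeff, Finset.mul_sum, ← Finset.sum_coe_sort]
  refine (congrArg (fun x => HasSum _ x) (Finset.sum_congr rfl fun p _ => ?_)).mpr
    (hasSum_fintype _)
  have := Finset.HasAntidiagonal.mem_antidiagonal.mp p.2
  simp only [Function.comp_apply, Finset.HasAntidiagonal.sigmaAntidiagonalEquivProd_apply]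
  rw [← pow_add, this, mul_comm]

theorem CauchyBound.divDiag {b : ℕ × ℕ → ℂ} (hb : CauchyBound b) : CauchyBound (divDiag b) := by
  intro r hr0 hr
  obtain ⟨R, hrR, hR⟩ := exists_between hr
  have hR0 := hr0.trans hrR
  obtain ⟨C, hC⟩ := hb R hR0 hR
  have hx : ‖r / R‖ < 1 := by
    rwa [Real.norm_of_nonneg (by positivity), div_lt_one hR0]
  have hx1 : r / R ≤ 1 := by rw [Real.norm_of_nonneg (by positivity)] at hx; exact hx.le
  have hsum : Summable fun n : ℕ => ((n : ℝ) + 1) * (r / R) ^ n := by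
    simpa [add_mul] using (summable_pow_mul_geometric_of_norm_lt_one (R := ℝ) 1 hx).add
      (summable_geometric_of_norm_lt_one hx)
  have hC0 : 0 ≤ C := (by positivity : (0 : ℝ) ≤ _).trans (hC 0)
  refine ⟨C / R * ∑' n : ℕ, ((n : ℝ) + 1) * (r / R) ^ n, fun ⟨i, l⟩ => ?_⟩
  have h1 : ‖Bidisc.divDiag b (i, l)‖ ≤ (l + 1) * (C / R ^ (i + 1 + l)) := by
    refine (norm_sum_le _ _).trans ((Finset.sum_le_card_nsmul _ _ (C / R ^ (i + 1 + l))
      fun q hq => ?_).trans (by simp))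
    have := hC (i + 1 + q.1, q.2)
    simp only [add_assoc, Finset.HasAntidiagonal.mem_antidiagonal.mp hq] at this ⊢
    rwa [le_div_iff₀ (by positivity)]
  calc _ ≤ (l + 1) * (C / R ^ (i + 1 + l)) * r ^ (i + l) := by gcongr
    _ = C / R * ((l + 1) * (r / R) ^ l) * (r / R) ^ i := by
        rw [div_pow, div_pow]
        field_simp
        ring
    _ ≤ C / R * ((l + 1) * (r / R) ^ l) * 1 := by
        gcongr
        exact pow_le_one₀ (by positivity) hx1
    _ ≤ _ := by
        rw [mul_one]
        gcongr
        exact hsum.le_tsum l fun _ _ => by positivity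

/-- A power series with vanishing restriction to the diagonal is divisible by `z₁ - z₂`. -/
theorem CauchyBound.powerSum_eq {b : ℕ × ℕ → ℂ} (hb : CauchyBound b)
    (hd : ∀ l, diagCoeff b l = 0) {z : ℂ × ℂ} (hz : z ∈ openBidisc) :
    powerSum b z = (z.1 - z.2) * powerSum (Bidisc.divDiag b) z := by
  have h := (hb.divDiag.summable hz).hasSum
  set c := Bidisc.divDiag b with hc
  have i1 : Function.Injective fun p : ℕ × ℕ => (p.1 + 1, p.2) := fun p q hpq => by
    simpa [Prod.ext_iff] using hpq
  have i2 : Function.Injective fun p : ℕ × ℕ => (p.1, p.2 + 1) := fun p q hpq => by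
    simpa [Prod.ext_iff] using hpq
  -- The series of `z₁ * powerSum c` and `z₂ * powerSum c`, indexed by their own exponents; their
  -- difference is compared with `b` coefficient by coefficient.
  have h1 : HasSum (fun p : ℕ × ℕ => (if p.1 = 0 then 0 else c (p.1 - 1, p.2)) *
      (z.1 ^ p.1 * z.2 ^ p.2)) (z.1 * powerSum c z) := by
    refine (i1.hasSum_iff ?_).mp ?_
    · rintro ⟨_ | m, n⟩ hp
      · simp
      · exact (hp ⟨(m, n), rfl⟩).elim
    · refine (congrArg (HasSum · _) (funext fun p => ?_)).mp (h.mul_left z.1)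
      simp [pow_succ]
      ring
  have h2 : HasSum (fun p : ℕ × ℕ => (if p.2 = 0 then 0 else c (p.1, p.2 - 1)) *
      (z.1 ^ p.1 * z.2 ^ p.2)) (z.2 * powerSum c z) := by
    refine (i2.hasSum_iff ?_).mp ?_
    · rintro ⟨m, _ | n⟩ hp
      · simp
      · exact (hp ⟨(m, n), rfl⟩).elim
    · refine (congrArg (HasSum · _) (funext fun p => ?_)).mp (h.mul_left z.2)
      simp [pow_succ]
      ring
  rw [sub_mul, ← (h1.sub h2).tsum_eq, powerSum]
  refine tsum_congr fun p => ?_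
  rw [← sub_mul]
  congr 1
  rcases p with ⟨_ | m, _ | n⟩
  · simpa [diagCoeff] using hd 0
  · have := hd (n + 1)
    rw [diagCoeff, Finset.Nat.sum_antidiagonal_succ] at this
    simp only [if_true, Nat.add_eq_zero_iff, one_ne_zero, and_false, if_false, hc, Bidisc.divDiag,
      Nat.add_sub_cancel, zero_sub]
    rw [eq_neg_of_add_eq_zero_left this]
    simp only [zero_add, add_comm 1]
  · simp [hc, Bidisc.divDiag]
  · simp only [Nat.add_eq_zero_iff, one_ne_zero, and_false, if_false, hc, Bidisc.divDiag,
      Nat.add_sub_cancel, Finset.Nat.sum_antidiagonal_succ]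
    have hidx : ∀ q : ℕ × ℕ, m + 1 + (q.1 + 1) = m + 1 + 1 + q.1 := fun q => by omega
    simp [hidx]

/-- The coefficients of the Taylor series at the origin of an element of `M^(λ,μ)`. -/
def HilbM.taylor {lam mu : PosReal} (h : HilbM lam mu) (p : ℕ × ℕ) : ℂ :=
  h.coeff p * ((√(binomCoeff lam p.1) : ℂ) * (√(binomCoeff mu p.2) : ℂ))

theorem HilbM.hasSum_taylor {lam mu : PosReal} (h : HilbM lam mu) (z : openBidisc) :
    HasSum (fun p : ℕ × ℕ => h.taylor p * ((z : ℂ × ℂ).1 ^ p.1 * (z : ℂ × ℂ).2 ^ p.2)) (h z) := by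
  refine (congrArg (HasSum · _) (funext fun p => ?_)).mp (h.hasSum_apply z)
  simp only [taylor, basisFun]
  ring

theorem HilbM.cauchyBound_taylor {lam mu : PosReal} (h : HilbM lam mu) : CauchyBound h.taylor :=
  .of_summable fun z hz => (h.hasSum_taylor ⟨z, hz⟩).summable

theorem HilbM.powerSum_taylor {lam mu : PosReal} (h : HilbM lam mu) (z : openBidisc) :
    powerSum h.taylor z = h z := (h.hasSum_taylor z).tsum_eq

theorem continuous_coeff {lam mu : PosReal} (p : ℕ × ℕ) :
    Continuous fun h : HilbM lam mu => h.coeff p :=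
  (lp.evalCLM ℂ (fun _ : ℕ × ℕ => ℂ) 2 p).continuous

theorem continuous_taylor {lam mu : PosReal} (p : ℕ × ℕ) :
    Continuous fun h : HilbM lam mu => h.taylor p :=
  (continuous_coeff p).mul continuous_const

/-- Vanishing to order two on the diagonal is expressed by finite sums of Taylor coefficients: these
sums are the Taylor coefficients of the restrictions to the diagonal of the function and of its
quotient by `z₁ - z₂`. -/
theorem mem_vanishing_two_iff {lam mu : PosReal} (h : HilbM lam mu) :
    h ∈ vanishing 2 lam mu ↔
      (∀ l, diagCoeff h.taylor l = 0) ∧ ∀ l, diagCoeff (divDiag h.taylor) l = 0 := by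
  have hb := h.cauchyBound_taylor
  constructor
  · rintro ⟨g, ⟨G, hG, hg⟩, e⟩
    have e' : ∀ z ∈ openBidisc, powerSum h.taylor z = (z.1 - z.2) ^ 2 * G z := fun z hz => by
      rw [h.powerSum_taylor ⟨z, hz⟩, e, hg]
    have hd : ∀ l, diagCoeff h.taylor l = 0 := eq_zero_of_powerSeries fun t ht => by
      have := hb.hasSum_diag ht
      rw [e' (t, t) ⟨mem_ball_zero_iff.mpr ht, mem_ball_zero_iff.mpr ht⟩] at this
      simpa using this
    refine ⟨hd, eq_zero_of_powerSeries fun t ht => ?_⟩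
    have ht' : t ∈ ball (0 : ℂ) 1 := mem_ball_zero_iff.mpr ht
    have hopen : IsOpen openBidisc := isOpen_ball.prod isOpen_ball
    have hmem : openBidisc ∈ nhds (t, t) := hopen.mem_nhds ⟨ht', ht'⟩
    have hc : ContinuousAt (fun s : ℂ => (t, s)) t := by fun_prop
    have c1 : ContinuousAt (fun s => powerSum (divDiag h.taylor) (t, s)) t :=
      ContinuousAt.comp (f := fun s : ℂ => (t, s))
        (hb.divDiag.differentiableOn.continuousOn.continuousAt hmem) hc
    have c2 : ContinuousAt (fun s => (t - s) * G (t, s)) t :=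
      (by fun_prop : ContinuousAt (fun s => t - s) t).mul
        (ContinuousAt.comp (f := fun s : ℂ => (t, s)) (hG.continuousOn.continuousAt hmem) hc)
    -- Off the diagonal one factor `z₁ - z₂` cancels; the diagonal is reached by continuity.
    have heq := (c1.eventuallyEq_nhds_iff_eventuallyEq_nhdsNE c2).mp (by
      filter_upwards [self_mem_nhdsWithin, nhdsWithin_le_nhds (isOpen_ball.mem_nhds ht')] with s hs hs'
      have h1 := e' (t, s) ⟨ht', hs'⟩
      rw [hb.powerSum_eq hd ⟨ht', hs'⟩, pow_two, mul_assoc] at h1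
      exact mul_left_cancel₀ (sub_ne_zero.mpr (Ne.symm hs)) h1)
    have h0 := heq.self_of_nhds
    simp only [sub_self, zero_mul] at h0
    rw [← h0]
    exact hb.divDiag.hasSum_diag ht
  · rintro ⟨h1, h2⟩
    refine ⟨fun z => powerSum (divDiag (divDiag h.taylor)) z,
      ⟨_, hb.divDiag.divDiag.differentiableOn, fun _ => rfl⟩, fun z => ?_⟩
    rw [← h.powerSum_taylor, hb.powerSum_eq h1 z.2, hb.divDiag.powerSum_eq h2 z.2]
    ring

theorem isClosed_vanishing_two (lam mu : PosReal) :
    IsClosed (vanishing 2 lam mu : Set (HilbM lam mu)) := by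
  have : (vanishing 2 lam mu : Set (HilbM lam mu)) =
      (⋂ l, {h | diagCoeff h.taylor l = 0}) ∩ ⋂ l, {h | diagCoeff (divDiag h.taylor) l = 0} := by
    ext h
    simpa using mem_vanishing_two_iff h
  rw [this]
  exact (isClosed_iInter fun l => isClosed_eq
      (continuous_finsetSum _ fun p _ => continuous_taylor p) continuous_const).inter
    (isClosed_iInter fun l => isClosed_eq (continuous_finsetSum _ fun p _ =>
      (continuous_finsetSum _ fun q _ => continuous_taylor _ :
        Continuous fun h : HilbM lam mu => divDiag h.taylor p)) continuous_const)

/-! ### Multiplication by polynomials -/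

theorem HilbM.summable_norm_sq_coeff {lam mu : PosReal} (h : HilbM lam mu) :
    Summable fun p => ‖h.coeff p‖ ^ 2 := by
  have := (lp.memℓp (show lp (fun _ : ℕ × ℕ => ℂ) 2 from h)).summable (by norm_num)
  simp only [ENNReal.toReal_ofNat, Real.rpow_ofNat] at this
  exact this

theorem exists_coeff_eq (lam mu : PosReal) {a : ℕ × ℕ → ℂ} (ha : Summable fun p => ‖a p‖ ^ 2) :
    ∃ k : HilbM lam mu, ∀ p, k.coeff p = a p :=
  ⟨(⟨a, memℓp_gen (by simpa using ha)⟩ : lp (fun _ : ℕ × ℕ => ℂ) 2), fun _ => rfl⟩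

/-- A function that multiplies the basis functions by a bounded weighted shift multiplies `M^(λ,μ)`
into itself. -/
theorem exists_mul_of_shift {lam mu : PosReal} {ζ : openBidisc → ℂ} {ι : ℕ × ℕ → ℕ × ℕ}
    (hι : Function.Injective ι) {w : ℕ × ℕ → ℝ} {C : ℝ} (hw : ∀ p, |w p| ≤ C)
    (hb : ∀ p (z : openBidisc), w p * basisFun lam mu (ι p) z = ζ z * basisFun lam mu p z)
    (h : HilbM lam mu) : ∃ k : HilbM lam mu, ∀ z, k z = ζ z * h z := by
  have hsum : Summable fun p => ‖Function.extend ι (fun p => h.coeff p * w p) 0 p‖ ^ 2 := by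
    refine (hι.summable_iff fun p hp => ?_).mp ?_
    · rw [Function.extend_apply' _ _ _ (by simpa using hp)]
      simp
    · refine (h.summable_norm_sq_coeff.mul_right (C ^ 2)).of_nonneg_of_le
        (fun p => sq_nonneg _) fun p => ?_
      rw [Function.comp_apply, hι.extend_apply, norm_mul, mul_pow, Complex.norm_real,
        Real.norm_eq_abs]
      gcongr
      exact hw p
  obtain ⟨k, hk⟩ := exists_coeff_eq lam mu hsum
  refine ⟨k, fun z => (k.hasSum_apply z).unique ((hι.hasSum_iff fun p hp => ?_).mp ?_)⟩
  · rw [hk, Function.extend_apply' _ _ _ (by simpa using hp)]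
    simp
  · refine (congrArg (HasSum · _) (funext fun p => ?_)).mp ((h.hasSum_apply z).mul_left (ζ z))
    rw [Function.comp_apply, hk, hι.extend_apply, mul_assoc, hb, mul_left_comm]

/-- The weights of the shift are bounded because `c_n / c_{n+1} = (n + 1) / (λ + n)`. -/
theorem abs_sqrt_binomCoeff_div_le (lam : PosReal) (n : ℕ) :
    |√(binomCoeff lam n) / √(binomCoeff lam (n + 1))| ≤ √(1 + 1 / lam) := by
  have hl : (0 : ℝ) < lam := lam.2
  rw [abs_of_nonneg (by positivity), ← Real.sqrt_div (binomCoeff_pos lam n).le, binomCoeff_succ]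
  refine Real.sqrt_le_sqrt ?_
  have h := (binomCoeff_pos lam n).ne'
  rw [div_mul_eq_div_div, div_self h, one_div_div, div_le_iff₀ (by positivity)]
  field_simp
  nlinarith [(n.cast_nonneg : (0 : ℝ) ≤ n)]

theorem sqrt_div_mul_sqrt (lam : PosReal) (n : ℕ) :
    ((√(binomCoeff lam n) / √(binomCoeff lam (n + 1)) : ℝ) : ℂ) * (√(binomCoeff lam (n + 1)) : ℝ) =
      (√(binomCoeff lam n) : ℝ) := by
  rw [← Complex.ofReal_mul, div_mul_cancel₀ _ (Real.sqrt_pos.mpr (binomCoeff_pos lam _)).ne']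

theorem coord_fst_mem_actingAlgebra (lam mu : PosReal) :
    (⟨fun z => (z : ℂ × ℂ).1, by fun_prop⟩ : C(closedBidisc, ℂ)) ∈ actingAlgebra lam mu := by
  refine ⟨⟨Prod.fst, differentiableOn_fst, fun _ => rfl⟩, fun h => ?_⟩
  refine exists_mul_of_shift (ι := fun p => (p.1 + 1, p.2)) (fun p q hpq => ?_)
    (fun p => abs_sqrt_binomCoeff_div_le lam p.1) (fun p z => ?_) h
  · simpa [Prod.ext_iff] using hpq
  · simp only [basisFun, ← sqrt_div_mul_sqrt lam p.1, incl, ContinuousMap.coe_mk]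
    ring

theorem coord_snd_mem_actingAlgebra (lam mu : PosReal) :
    (⟨fun z => (z : ℂ × ℂ).2, by fun_prop⟩ : C(closedBidisc, ℂ)) ∈ actingAlgebra lam mu := by
  refine ⟨⟨Prod.snd, differentiableOn_snd, fun _ => rfl⟩, fun h => ?_⟩
  refine exists_mul_of_shift (ι := fun p => (p.1, p.2 + 1)) (fun p q hpq => ?_)
    (fun p => abs_sqrt_binomCoeff_div_le mu p.2) (fun p z => ?_) h
  · simpa [Prod.ext_iff] using hpq
  · simp only [basisFun, ← sqrt_div_mul_sqrt mu p.2, incl, ContinuousMap.coe_mk]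
    ring

theorem polynomial_mem_actingAlgebra (lam mu : PosReal) (f : C(closedBidisc, ℂ))
    (P : MvPolynomial (Fin 2) ℂ)
    (hf : ∀ z, f z = MvPolynomial.eval ![(z : ℂ × ℂ).1, (z : ℂ × ℂ).2] P) :
    f ∈ actingAlgebra lam mu := by
  suffices ∃ g ∈ actingAlgebra lam mu, ∀ z,
      g z = MvPolynomial.eval ![(z : ℂ × ℂ).1, (z : ℂ × ℂ).2] P by
    obtain ⟨g, hg, hg'⟩ := this
    rwa [show f = g from ContinuousMap.ext fun z => by rw [hf, hg']]
  clear hf f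
  induction P using MvPolynomial.induction_on with
  | C a => exact ⟨_, (actingAlgebra lam mu).algebraMap_mem a, fun z => by simp⟩
  | add p q hp hq =>
    obtain ⟨g, hg, hg'⟩ := hp
    obtain ⟨k, hk, hk'⟩ := hq
    exact ⟨g + k, add_mem hg hk, fun z => by simp [hg', hk']⟩
  | mul_X p i hp =>
    obtain ⟨g, hg, hg'⟩ := hp
    fin_cases i
    · exact ⟨_, mul_mem hg (coord_fst_mem_actingAlgebra lam mu), fun z => by simp [hg']⟩
    · exact ⟨_, mul_mem hg (coord_snd_mem_actingAlgebra lam mu), fun z => by simp [hg']⟩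

/-! ### Cauchy's formula on the torus and the Szegő kernel -/

open MeasureTheory in
/-- The unnormalised mean over the torus, the distinguished boundary of the bidisc; constants are
multiplied by `(2 π) ^ 2`. -/
def torusMean (G : ℂ × ℂ → ℂ) : ℂ :=
  ∫ t : ℝ × ℝ in Set.Ioc 0 (2 * Real.pi) ×ˢ Set.Ioc 0 (2 * Real.pi),
    G (circleMap 0 1 t.1, circleMap 0 1 t.2)

/-- The Szegő kernel of the bidisc. -/
def szego (w ζ : ℂ × ℂ) : ℂ := (1 - ζ.1 * star w.1)⁻¹ * (1 - ζ.2 * star w.2)⁻¹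

/-- `F` is complex differentiable at every point of the closed bidisc, as a function on `ℂ²`,
including the points of the boundary. -/
def HoloClosed (F : ℂ × ℂ → ℂ) : Prop := ∀ ζ ∈ closedBidisc, DifferentiableAt ℂ F ζ

theorem circleMap_mem_closedBall (t : ℝ) : circleMap 0 1 t ∈ closedBall (0 : ℂ) 1 :=
  sphere_subset_closedBall (circleMap_mem_sphere 0 zero_le_one t)

theorem one_sub_ne_zero {z w : ℂ} (hz : ‖z‖ ≤ 1) (hw : ‖w‖ < 1) : 1 - z * star w ≠ 0 := by
  rw [mul_comm]
  exact mob_denom_ne hw hz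

theorem HoloClosed.szego {w : ℂ × ℂ} (hw : w ∈ openBidisc) : HoloClosed (szego w) := by
  intro ζ hζ
  have h1 := one_sub_ne_zero (mem_closedBall_zero_iff.mp hζ.1) (mem_ball_zero_iff.mp hw.1)
  have h2 := one_sub_ne_zero (mem_closedBall_zero_iff.mp hζ.2) (mem_ball_zero_iff.mp hw.2)
  unfold Bidisc.szego
  fun_prop (disch := assumption)

theorem HoloClosed.mul {F G : ℂ × ℂ → ℂ} (hF : HoloClosed F) (hG : HoloClosed G) :
    HoloClosed fun ζ => F ζ * G ζ := fun ζ hζ => (hF ζ hζ).mul (hG ζ hζ)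

theorem HoloClosed.sum {ι : Type*} (s : Finset ι) (a : ι → ℂ) {F : ι → ℂ × ℂ → ℂ}
    (hF : ∀ i, HoloClosed (F i)) : HoloClosed fun ζ => ∑ i ∈ s, a i * F i ζ := fun ζ hζ =>
  DifferentiableAt.fun_sum fun i _ => (hF i ζ hζ).const_mul (a i)

theorem HoloClosed.continuous {F : ℂ × ℂ → ℂ} (hF : HoloClosed F) :
    Continuous fun t : ℝ × ℝ => F (circleMap 0 1 t.1, circleMap 0 1 t.2) :=
  continuous_iff_continuousAt.mpr fun t => ContinuousAt.comp
    (f := fun t : ℝ × ℝ => (circleMap 0 1 t.1, circleMap 0 1 t.2))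
    (hF _ ⟨circleMap_mem_closedBall _, circleMap_mem_closedBall _⟩).continuousAt
    (by fun_prop)

theorem integrableOn_torus {E : Type*} [NormedAddCommGroup E] {G : ℝ × ℝ → E} (hG : Continuous G) :
    MeasureTheory.IntegrableOn G (Set.Ioc 0 (2 * Real.pi) ×ˢ Set.Ioc 0 (2 * Real.pi)) := by
  have h : IsCompact (Set.Icc 0 (2 * Real.pi) ×ˢ Set.Icc 0 (2 * Real.pi)) :=
    isCompact_Icc.prod isCompact_Icc
  exact (hG.continuousOn.integrableOn_compact h).mono_set
    (Set.prod_mono Set.Ioc_subset_Icc_self Set.Ioc_subset_Icc_self)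

/-- Cauchy's formula on the circle, with the Cauchy kernel written as a conjugate Szegő kernel. -/
theorem integral_circle_szego {F : ℂ → ℂ} (hF : ∀ ζ ∈ closedBall (0 : ℂ) 1, DifferentiableAt ℂ F ζ)
    {w : ℂ} (hw : ‖w‖ < 1) :
    ∫ t in Set.Ioc 0 (2 * Real.pi), F (circleMap 0 1 t) * star ((1 - circleMap 0 1 t * star w)⁻¹) =
      (2 * Real.pi : ℝ) * F w := by
  have hd : DiffContOnCl ℂ F (ball 0 |1|) := by
    refine DifferentiableOn.diffContOnCl fun ζ hζ => (hF ζ ?_).differentiableWithinAt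
    simpa using closure_ball_subset_closedBall hζ
  have h := hd.circleAverage_smul_div (w := w) (by simpa using hw)
  rw [Real.circleAverage, inv_smul_eq_iff₀ (by positivity), Complex.real_smul,
    intervalIntegral.integral_of_le (by positivity)] at h
  rw [← h]
  refine MeasureTheory.integral_congr_ae (.of_forall fun t => ?_)
  have hn : ‖circleMap 0 1 t‖ = 1 := by simp
  have h1 : circleMap 0 1 t * star (circleMap 0 1 t) = 1 := by
    rw [Complex.star_def, Complex.mul_conj, Complex.normSq_eq_norm_sq, hn]
    simp
  simp only [sub_zero, smul_eq_mul]
  generalize circleMap 0 1 t = ζ at hn h1 ⊢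
  have h2 : star (1 - ζ * star w) ≠ 0 := star_ne_zero.mpr (one_sub_ne_zero hn.le hw)
  have h3 : ζ - w = ζ * star (1 - ζ * star w) := by
    simp only [star_sub, star_one, star_mul', star_star]
    linear_combination w * h1
  have h4 : ζ ≠ 0 := fun h => by simp [h] at hn
  rw [h3, star_inv₀, div_mul_cancel_left₀ h4, mul_comm]

/-- Cauchy's formula on the torus: the Szegő kernel reproduces the value at `w`. -/
theorem torusMean_mul_star_szego {F : ℂ × ℂ → ℂ} (hF : HoloClosed F) {w : ℂ × ℂ}
    (hw : w ∈ openBidisc) :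
    torusMean (fun ζ => F ζ * star (szego w ζ)) = ((2 * Real.pi) ^ 2 : ℝ) * F w := by
  have hint : MeasureTheory.IntegrableOn (fun t : ℝ × ℝ =>
      F (circleMap 0 1 t.1, circleMap 0 1 t.2) *
        star (szego w (circleMap 0 1 t.1, circleMap 0 1 t.2)))
      (Set.Ioc 0 (2 * Real.pi) ×ˢ Set.Ioc 0 (2 * Real.pi)) := integrableOn_torus
    (hF.continuous.mul (continuous_star.comp (HoloClosed.szego hw).continuous))
  have hw1 := mem_ball_zero_iff.mp hw.1
  have hw2 := mem_ball_zero_iff.mp hw.2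
  rw [torusMean]
  refine (MeasureTheory.setIntegral_prod _ hint).trans ?_
  have h1 : ∀ x : ℝ, ∫ y in Set.Ioc 0 (2 * Real.pi), F (circleMap 0 1 x, circleMap 0 1 y) *
      star (szego w (circleMap 0 1 x, circleMap 0 1 y)) =
      (2 * Real.pi : ℝ) * (F (circleMap 0 1 x, w.2) *
        star ((1 - circleMap 0 1 x * star w.1)⁻¹)) := by
    intro x
    have := integral_circle_szego (F := fun ζ => F (circleMap 0 1 x, ζ)) (fun ζ hζ =>
      DifferentiableAt.comp (f := fun ζ : ℂ => (circleMap 0 1 x, ζ)) ζ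
        (hF (circleMap 0 1 x, ζ) ⟨circleMap_mem_closedBall x, hζ⟩) (by fun_prop)) hw2
    rw [← mul_assoc, ← this, ← MeasureTheory.integral_mul_const]
    refine MeasureTheory.integral_congr_ae (.of_forall fun y => ?_)
    simp only [szego, star_mul']
    ring
  have h2 := integral_circle_szego (F := fun ζ => F (ζ, w.2)) (fun ζ hζ =>
      DifferentiableAt.comp (f := fun ζ : ℂ => (ζ, w.2)) ζ
        (hF (ζ, w.2) ⟨hζ, ball_subset_closedBall hw.2⟩) (by fun_prop)) hw1
  simp_rw [h1]
  rw [MeasureTheory.integral_const_mul, h2]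
  push_cast
  ring

theorem torusMean_mul_star_sum {ι : Type*} (s : Finset ι) (a : ι → ℂ) (w : ι → openBidisc)
    {F : ℂ × ℂ → ℂ} (hF : HoloClosed F) :
    torusMean (fun ζ => F ζ * star (∑ i ∈ s, a i * szego (w i) ζ)) =
      ((2 * Real.pi) ^ 2 : ℝ) * ∑ i ∈ s, star (a i) * F (w i) := by
  have h : ∀ i, MeasureTheory.IntegrableOn
      (fun t : ℝ × ℝ => star (a i) * (F (circleMap 0 1 t.1, circleMap 0 1 t.2) *
        star (szego (w i) (circleMap 0 1 t.1, circleMap 0 1 t.2))))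
      (Set.Ioc 0 (2 * Real.pi) ×ˢ Set.Ioc 0 (2 * Real.pi)) := fun i =>
    integrableOn_torus (continuous_const.mul
      (hF.continuous.mul (continuous_star.comp (HoloClosed.szego (w i).2).continuous)))
  have h2 := MeasureTheory.integral_finsetSum s fun i _ => h i
  rw [Finset.mul_sum]
  refine Eq.trans ?_ (h2.trans (Finset.sum_congr rfl fun i _ => ?_))
  · refine MeasureTheory.integral_congr_ae (.of_forall fun t => ?_)
    simp only [star_sum, star_mul', Finset.mul_sum]
    exact Finset.sum_congr rfl fun i _ => by ring
  · have h3 := torusMean_mul_star_szego hF (w i).2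
    rw [torusMean] at h3
    rw [MeasureTheory.integral_const_mul, h3]
    ring

/-- The quadratic form in `c` of the kernel `f(z) conj f(w) S(z, w)`, with `S` the Szegő kernel. -/
def szegoForm {ι : Type*} (s : Finset ι) (z : ι → openBidisc) (f c : ι → ℂ) : ℂ :=
  ∑ i ∈ s, ∑ j ∈ s, star (c i) * c j * (f i * star (f j)) * szego (z j) (z i)

/-- The kernel `(M² - f(z) conj f(w)) S(z, w)` is positive semidefinite. With `u = ∑ c_j S_{z_j}`
and `v = ∑ c_j conj (f z_j) S_{z_j}`, the projection of `conj f * u` to the Hardy space, this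
expresses `‖conj f * u - v‖² ≥ 0` on the torus, the inner products being evaluated by Cauchy's
formula. -/
theorem szegoForm_le_of_holoClosed {ι : Type*} (s : Finset ι) (z : ι → openBidisc) (c : ι → ℂ)
    {F : ℂ × ℂ → ℂ} (hF : HoloClosed F) {M : ℝ} (hM : ∀ ζ ∈ closedBidisc, ‖F ζ‖ ≤ M) :
    (szegoForm s z (fun i => F (z i)) c).re ≤ M ^ 2 * (szegoForm s z (fun _ => 1) c).re := by
  set u : ℂ × ℂ → ℂ := fun ζ => ∑ j ∈ s, c j * szego (z j) ζ with hu
  set v : ℂ × ℂ → ℂ := fun ζ => ∑ j ∈ s, (c j * star (F (z j))) * szego (z j) ζ with hv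
  have hu' : HoloClosed u := HoloClosed.sum s c fun i => HoloClosed.szego (z i).2
  have hv' : HoloClosed v := HoloClosed.sum s _ fun i => HoloClosed.szego (z i).2
  have e1 : torusMean (fun ζ => u ζ * star (u ζ)) =
      ((2 * Real.pi) ^ 2 : ℝ) * szegoForm s z (fun _ => 1) c := by
    refine (torusMean_mul_star_sum s c z hu').trans ?_
    simp only [szegoForm, hu, Finset.mul_sum]
    refine Finset.sum_congr rfl fun i _ => Finset.sum_congr rfl fun j _ => ?_
    rw [star_one]
    ring
  have e2 : torusMean (fun ζ => (F ζ * v ζ) * star (u ζ)) =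
      ((2 * Real.pi) ^ 2 : ℝ) * szegoForm s z (fun i => F (z i)) c := by
    refine (torusMean_mul_star_sum s c z (hF.mul hv')).trans ?_
    simp only [szegoForm, hv, Finset.mul_sum]
    refine Finset.sum_congr rfl fun i _ => Finset.sum_congr rfl fun j _ => ?_
    ring
  have e3 : torusMean (fun ζ => v ζ * star (v ζ)) =
      ((2 * Real.pi) ^ 2 : ℝ) * szegoForm s z (fun i => F (z i)) c := by
    refine (torusMean_mul_star_sum s _ z hv').trans ?_
    simp only [szegoForm, hv, Finset.mul_sum]
    refine Finset.sum_congr rfl fun i _ => Finset.sum_congr rfl fun j _ => ?_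
    simp only [star_mul', star_star]
    ring
  have i1 : MeasureTheory.IntegrableOn (fun t : ℝ × ℝ => u (circleMap 0 1 t.1, circleMap 0 1 t.2) *
      star (u (circleMap 0 1 t.1, circleMap 0 1 t.2))) (Set.Ioc 0 (2 * Real.pi) ×ˢ Set.Ioc 0 (2 * Real.pi)) :=
    integrableOn_torus (hu'.continuous.mul (continuous_star.comp hu'.continuous))
  have i2 : MeasureTheory.IntegrableOn (fun t : ℝ × ℝ => (F (circleMap 0 1 t.1, circleMap 0 1 t.2) *
      v (circleMap 0 1 t.1, circleMap 0 1 t.2)) *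
      star (u (circleMap 0 1 t.1, circleMap 0 1 t.2))) (Set.Ioc 0 (2 * Real.pi) ×ˢ Set.Ioc 0 (2 * Real.pi)) :=
    integrableOn_torus ((hF.mul hv').continuous.mul (continuous_star.comp hu'.continuous))
  have i3 : MeasureTheory.IntegrableOn (fun t : ℝ × ℝ => v (circleMap 0 1 t.1, circleMap 0 1 t.2) *
      star (v (circleMap 0 1 t.1, circleMap 0 1 t.2))) (Set.Ioc 0 (2 * Real.pi) ×ˢ Set.Ioc 0 (2 * Real.pi)) :=
    integrableOn_torus (hv'.continuous.mul (continuous_star.comp hv'.continuous))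
  have hI := (((i1.const_mul ((M ^ 2 : ℝ) : ℂ)).sub (i2.const_mul 2)).add i3)
  -- The integrand is `M² |u|² - 2 F v ū + |v|²`, whose real part is at least `|conj F * u - v|²`.
  have key : 0 ≤ (((M ^ 2 : ℝ) : ℂ) * torusMean (fun ζ => u ζ * star (u ζ)) -
      2 * torusMean (fun ζ => (F ζ * v ζ) * star (u ζ)) +
      torusMean (fun ζ => v ζ * star (v ζ))).re := by
    have h := MeasureTheory.integral_add ((i1.const_mul ((M ^ 2 : ℝ) : ℂ)).sub (i2.const_mul 2)) i3
    have h' := MeasureTheory.integral_sub (i1.const_mul ((M ^ 2 : ℝ) : ℂ)) (i2.const_mul 2)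
    simp only [MeasureTheory.integral_const_mul, Pi.sub_apply] at h h'
    rw [h'] at h
    simp only [torusMean]
    rw [← h]
    have h4 := integral_re hI
    refine le_of_le_of_eq ?_ h4
    refine MeasureTheory.integral_nonneg fun t => ?_
    have hm := hM (circleMap 0 1 t.1, circleMap 0 1 t.2)
      ⟨circleMap_mem_closedBall _, circleMap_mem_closedBall _⟩
    simp only [Pi.zero_apply, Pi.add_apply, Pi.sub_apply]
    generalize F (circleMap 0 1 t.1, circleMap 0 1 t.2) = a at hm ⊢
    generalize u (circleMap 0 1 t.1, circleMap 0 1 t.2) = x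
    generalize v (circleMap 0 1 t.1, circleMap 0 1 t.2) = y
    have h5 : Complex.normSq a ≤ M ^ 2 := by
      rw [Complex.normSq_eq_norm_sq]
      gcongr
    have h6 := mul_le_mul_of_nonneg_right h5 (Complex.normSq_nonneg x)
    have h7 := Complex.normSq_nonneg (star a * x - y)
    simp only [Complex.normSq_apply, RCLike.re_to_complex, Complex.add_re, Complex.sub_re,
      Complex.sub_im, Complex.mul_re, Complex.mul_im, Complex.star_def, Complex.conj_re,
      Complex.conj_im, Complex.ofReal_re, Complex.ofReal_im, Complex.re_ofNat,
      Complex.im_ofNat] at h6 h7 ⊢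
    nlinarith [h6, h7]
  rw [e1, e2, e3] at key
  have hpos : (0 : ℝ) < (2 * Real.pi) ^ 2 := by positivity
  generalize (2 * Real.pi) ^ 2 = N at key hpos
  have h8 : 0 ≤ N * (M ^ 2 * (szegoForm s z (fun _ => 1) c).re -
      (szegoForm s z (fun i => F (z i)) c).re) := by
    refine key.trans (le_of_eq ?_)
    simp only [Complex.add_re, Complex.sub_re, Complex.mul_re, Complex.mul_im,
      Complex.re_ofNat, Complex.im_ofNat, Complex.ofReal_re, Complex.ofReal_im]
    ring
  linarith [nonneg_of_mul_nonneg_right h8 hpos]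

/-! ### Contractive multiplication for `λ, μ ≥ 1` -/

/-- The kernel `(‖f‖² - f(z) conj f(w)) S(z, w)` is positive semidefinite for `f` in the bidisc
algebra: the dilates `f (r z)` are holomorphic on the closed bidisc, and `r` tends to `1`. -/
theorem szegoForm_le {ι : Type*} (s : Finset ι) (z : ι → openBidisc) (c : ι → ℂ)
    {f : C(closedBidisc, ℂ)} (hf : f ∈ bidiscAlgebra) :
    (szegoForm s z (fun i => f (incl (z i))) c).re ≤
      ‖f‖ ^ 2 * (szegoForm s z (fun _ => 1) c).re := by
  obtain ⟨G, hG, hfG⟩ := hf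
  have hopen : IsOpen openBidisc := isOpen_ball.prod isOpen_ball
  have hlim : ∀ i, Filter.Tendsto (fun r : ℝ => G ((r : ℂ) • (z i : ℂ × ℂ)))
      (nhdsWithin 1 (Set.Ioo 0 1)) (nhds (f (incl (z i)))) := fun i => by
    have h1 : ContinuousAt G (((1 : ℝ) : ℂ) • (z i : ℂ × ℂ)) := by
      rw [Complex.ofReal_one, one_smul]
      exact hG.continuousOn.continuousAt (hopen.mem_nhds (z i).2)
    have h2 : ContinuousAt (fun r : ℝ => G ((r : ℂ) • (z i : ℂ × ℂ))) 1 :=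
      ContinuousAt.comp (f := fun r : ℝ => (r : ℂ) • (z i : ℂ × ℂ)) h1 (by fun_prop)
    have h3 := h2.tendsto
    simp only [Complex.ofReal_one, one_smul] at h3
    rw [← hfG] at h3
    exact h3.mono_left nhdsWithin_le_nhds
  have hne : (nhdsWithin (1 : ℝ) (Set.Ioo 0 1)).NeBot := by
    rw [← mem_closure_iff_nhdsWithin_neBot, closure_Ioo zero_ne_one]
    simp
  have hform : Filter.Tendsto
      (fun r : ℝ => (szegoForm s z (fun i => G ((r : ℂ) • (z i : ℂ × ℂ))) c).re)
      (nhdsWithin 1 (Set.Ioo 0 1)) (nhds (szegoForm s z (fun i => f (incl (z i))) c).re) := by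
    refine (Complex.continuous_re.tendsto _).comp (tendsto_finsetSum _ fun i _ =>
      tendsto_finsetSum _ fun j _ => Filter.Tendsto.mul_const _ (Filter.Tendsto.const_mul _
        ((hlim i).mul ((continuous_star.tendsto _).comp (hlim j)))))
  refine le_of_tendsto hform ?_
  filter_upwards [self_mem_nhdsWithin] with r hr
  have hmem : ∀ ζ ∈ closedBidisc, (r : ℂ) • ζ ∈ openBidisc := fun ζ hζ => by
    have hr' : ‖(r : ℂ)‖ < 1 := by
      rw [Complex.norm_real, Real.norm_of_nonneg hr.1.le]
      exact hr.2
    constructor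
    · rw [mem_ball_zero_iff, Prod.smul_fst, norm_smul]
      exact mul_lt_one_of_nonneg_of_lt_one_left (norm_nonneg _) hr' (mem_closedBall_zero_iff.mp hζ.1)
    · rw [mem_ball_zero_iff, Prod.smul_snd, norm_smul]
      exact mul_lt_one_of_nonneg_of_lt_one_left (norm_nonneg _) hr' (mem_closedBall_zero_iff.mp hζ.2)
  refine szegoForm_le_of_holoClosed s z c (F := fun ζ => G ((r : ℂ) • ζ)) (fun ζ hζ => ?_)
    fun ζ hζ => ?_
  · exact DifferentiableAt.comp (f := fun ζ : ℂ × ℂ => (r : ℂ) • ζ) ζ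
      (hG.differentiableAt (hopen.mem_nhds (hmem ζ hζ))) (by fun_prop)
  · rw [← hfG ⟨_, hmem ζ hζ⟩]
    exact f.norm_coe_le_norm _

/-- The Taylor coefficients of `(1 - x) * (1 - x) ^ (-λ) = (1 - x) ^ (-(λ - 1))`, written as
differences of those of `(1 - x) ^ (-λ)`. -/
def binomDiff (lam : ℝ) : ℕ → ℝ
  | 0 => binomCoeff lam 0
  | n + 1 => binomCoeff lam (n + 1) - binomCoeff lam n

theorem binomDiff_nonneg {lam : PosReal} (hl : 1 ≤ (lam : ℝ)) (n : ℕ) : 0 ≤ binomDiff lam n := by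
  rcases n with _ | n
  · exact (binomCoeff_pos lam 0).le
  · rw [binomDiff, binomCoeff_succ, sub_nonneg]
    refine le_mul_of_one_le_right (binomCoeff_pos lam n).le ?_
    rw [one_le_div (by positivity)]
    linarith

theorem hasSum_binomDiff (lam : ℝ) {x : ℂ} (hx : ‖x‖ < 1) :
    HasSum (fun n => (binomDiff lam n : ℂ) * x ^ n)
      ((1 - x) * Complex.exp (-lam * Complex.log (1 - x))) := by
  have h := hasSum_binomCoeff lam hx
  have h0 : HasSum (fun n => if n = 0 then (0 : ℂ) else binomCoeff lam (n - 1) * x ^ n)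
      (x * Complex.exp (-lam * Complex.log (1 - x))) := by
    refine ((add_left_injective 1).hasSum_iff fun n hn => ?_).mp ?_
    · rcases n with _ | n
      · simp
      · exact (hn ⟨n, rfl⟩).elim
    · refine (congrArg (HasSum · _) (funext fun n => ?_)).mp (h.mul_left x)
      simp [pow_succ]
      ring
  rw [one_sub_mul]
  refine (congrArg (HasSum · _) (funext fun n => ?_)).mp (h.sub h0)
  rcases n with _ | n
  · simp [binomDiff]
  · simp [binomDiff, sub_mul]

theorem hasSum_mul_prod {f g : ℕ → ℂ} {a b : ℂ} (hf : HasSum f a) (hg : HasSum g b) :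
    HasSum (fun p : ℕ × ℕ => f p.1 * g p.2) (a * b) :=
  hf.mul hg (summable_mul_of_summable_norm hf.summable.norm hg.summable.norm)

/-- The kernel of `M^(λ,μ)` is the Szegő kernel times a power series in `z₁ w̄₁`, `z₂ w̄₂`, whose
coefficients are nonnegative if `λ, μ ≥ 1`. -/
theorem hasSum_szego_mul_kernel {lam mu : PosReal} (z w : openBidisc) :
    HasSum (fun p : ℕ × ℕ => szego w z *
        ((binomDiff lam p.1 * ((z : ℂ × ℂ).1 * star (w : ℂ × ℂ).1) ^ p.1) *
          (binomDiff mu p.2 * ((z : ℂ × ℂ).2 * star (w : ℂ × ℂ).2) ^ p.2)) : ℕ × ℕ → ℂ)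
      (inner ℂ (kernelVec lam mu z) (kernelVec lam mu w)) := by
  have hz1 := mem_ball_zero_iff.mp z.2.1
  have hz2 := mem_ball_zero_iff.mp z.2.2
  have hw1 := mem_ball_zero_iff.mp w.2.1
  have hw2 := mem_ball_zero_iff.mp w.2.2
  have h1 := hasSum_binomDiff lam (norm_mul_star_lt hz1 hw1)
  have h2 := hasSum_binomDiff mu (norm_mul_star_lt hz2 hw2)
  have h3 := hasSum_mul_prod h1 h2
  have n1 := one_sub_ne_zero hz1.le hw1
  have n2 := one_sub_ne_zero hz2.le hw2
  have h4 := h3.mul_left (szego w z)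
  have h5 : inner ℂ (kernelVec lam mu z) (kernelVec lam mu w) = szego w z * _ :=
    (inner_kernelVec_eq z w).trans (by
      rw [szego, mul_mul_mul_comm, inv_mul_cancel_left₀ n1, inv_mul_cancel_left₀ n2])
  rw [h5]
  exact h4

/-- The squared norm of a combination of the vectors `conj (J z) K_z` as a sum of Szegő forms: the
factors `(z₁ w̄₁) ^ m (z₂ w̄₂) ^ n` of the kernel are absorbed into the coefficients. -/
theorem hasSum_szegoForm {lam mu : PosReal} (J : openBidisc → ℂ) (x : openBidisc →₀ ℂ) :
    HasSum (fun p : ℕ × ℕ => binomDiff lam p.1 * binomDiff mu p.2 *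
        (szegoForm x.support id J fun z =>
          x z * star ((z : ℂ × ℂ).1 ^ p.1 * (z : ℂ × ℂ).2 ^ p.2)).re)
      (‖Finsupp.linearCombination ℂ (fun z => star (J z) • kernelVec lam mu z) x‖ ^ 2) := by
  have h : HasSum (fun p : ℕ × ℕ => (binomDiff lam p.1 * binomDiff mu p.2 : ℝ) *
        (szegoForm x.support id J fun z =>
          x z * star ((z : ℂ × ℂ).1 ^ p.1 * (z : ℂ × ℂ).2 ^ p.2)))
      ((‖Finsupp.linearCombination ℂ (fun z => star (J z) • kernelVec lam mu z) x‖ ^ 2 : ℝ) : ℂ) := by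
    rw [norm_sq_linearCombination]
    simp only [szegoForm, Finset.mul_sum]
    refine hasSum_sum fun i _ => hasSum_sum fun j _ => ?_
    have := (hasSum_szego_mul_kernel (lam := lam) (mu := mu) i j).mul_left
      (star (x i) * x j * (J i * star (J j)))
    rw [inner_smul_left, inner_smul_right]
    refine (congrArg₂ HasSum (funext fun p => ?_) ?_).mp this
    · simp only [star_mul', star_pow, star_star, id, mul_pow]
      push_cast
      ring
    · simp only [starRingEnd_apply, star_star]
      ring
  have h' := Complex.hasSum_re h
  simpa only [Complex.re_ofReal_mul, Complex.ofReal_re] using h'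

/-- For `λ, μ ≥ 1` the bidisc algebra acts on `M^(λ,μ)` by contractive multiplication. -/
theorem exists_multiplication {lam mu : PosReal} (hl : 1 ≤ (lam : ℝ)) (hm : 1 ≤ (mu : ℝ))
    {f : C(closedBidisc, ℂ)} (hf : f ∈ bidiscAlgebra) :
    ∃ T : HilbM lam mu →L[ℂ] HilbM lam mu,
      (∀ h z, T h z = f (incl z) * h z) ∧ ∀ h, ‖T h‖ ≤ ‖f‖ * ‖h‖ := by
  refine exists_weightedComp (fun z => f (incl z)) id (norm_nonneg f) fun x => ?_
  refine le_of_sq_le_sq ?_ (by positivity)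
  rw [mul_pow]
  have h1 := hasSum_szegoForm (lam := lam) (mu := mu) (fun z => f (incl z)) x
  have h2 := (hasSum_szegoForm (lam := lam) (mu := mu) (fun _ => 1) x).mul_left (‖f‖ ^ 2)
  simp only [star_one, one_smul] at h2
  refine hasSum_le (fun p => ?_) h1 h2
  rw [mul_left_comm]
  exact mul_le_mul_of_nonneg_left (szegoForm_le x.support id _ hf)
    (mul_nonneg (binomDiff_nonneg hl _) (binomDiff_nonneg hm _))

end Bidisc

end

theorem mainTheorem6 (lam mu : Bidisc.PosReal) :
    IsClosed (Bidisc.vanishing 2 lam mu : Set (Bidisc.HilbM lam mu)) ∧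
    (∀ f : C(Bidisc.closedBidisc, ℂ), (∃ P : MvPolynomial (Fin 2) ℂ,
        ∀ z, f z = MvPolynomial.eval ![(z : ℂ × ℂ).1, (z : ℂ × ℂ).2] P) →
      f ∈ Bidisc.actingAlgebra lam mu) ∧
    (1 ≤ (lam : ℝ) → 1 ≤ (mu : ℝ) →
      Bidisc.actingAlgebra lam mu = Bidisc.bidiscAlgebra ∧
      ∃ C : ℝ, ∀ (f : Bidisc.actingAlgebra lam mu) (h : Bidisc.HilbM lam mu),
        ‖f • h‖ ≤ C * ‖(f : C(Bidisc.closedBidisc, ℂ))‖ * ‖h‖) ∧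
    Bidisc.IsMobHomogeneous lam mu := by
  refine ⟨Bidisc.isClosed_vanishing_two lam mu,
    fun f ⟨P, hP⟩ => Bidisc.polynomial_mem_actingAlgebra lam mu f P hP, fun hl hm => ⟨?_, 1, ?_⟩,
    Bidisc.isMobHomogeneous lam mu⟩
  · refine le_antisymm (fun f hf => hf.1) fun f hf => ⟨hf, fun h => ?_⟩
    obtain ⟨T, hT, -⟩ := Bidisc.exists_multiplication hl hm hf
    exact ⟨T h, hT h⟩
  · intro f h
    obtain ⟨T, hT, hnorm⟩ := Bidisc.exists_multiplication hl hm f.2.1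
    have : f • h = T h := RKHS.ext fun z => by rw [Bidisc.smul_apply, hT]
    rw [this, one_mul]
    exact hnorm h
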